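/- Setting. Let $n\ge 2$, $M>0$, and let $h_j:\mathbb R^{n-j}\to\mathbb R$ ($1\le j\le n-1$) be $C^2$ functions with $|h_j(X)|\le M|X|^2$ whenever $|X|_\infty\le 1$. They are the nonlinearities of the feedforward system $\dot x_j=x_{j+1}+h_j(x_{j+1},\dots,x_n)$ ($j<n$), $\dot x_n=u$. Let $\kappa\ge 1$, $0<L\le\min\{M,\,M\kappa/(n+1)!\}$, let $\theta\ge 0$ be the delay of the channel, and put $\tau=\theta/\kappa$, $P=n^3(n!)^3L\kappa^{-1}$ and $\varepsilon_j=30^{-(n-j+1)}$, $1\le j\le n$. Let $\sigma:\mathbb R\to\mathbb R$ be odd and $C^1$ with $0\le\sigma'\le 1$, $\sigma(s)=1$ for $s\ge 21/20$ and $\sigma(s)=s$ for $0\le s\le 19/20$, and let $\sigma_j(s)=\varepsilon_j\sigma(s/\varepsilon_j)$. Let $\Phi$ be the invertible matrix with $(\Phi x)_i=\sum_{j=i}^n\frac{(n-i)!}{(n-j)!(j-i)!}\frac ML\kappa^{j-1}x_j$, and put $\varphi(z)=\kappa\,\Phi\,\big(h_1(x_2,\dots,x_n),\dots,h_{n-1}(x_n),0\big)^T$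 with $x=\Phi^{-1}z$. Let $\bar\ell\in\mathbb R^n$ be a bound on the initial conditions. The transmission times satisfy $T_m\le t_{k+1}-t_k\le T_M$, $k\ge 0$, with $T_m>0$; put $r_0=t_0/\kappa$ and $\rho_k=(t_k+\theta)/\kappa$. A trajectory of the closed-loop impulsive system with update matrix $\Lambda\in\mathbb R^{n\times n}$ is a triple $(z,e,p)$ where $z$ is continuous on $[r_0,\infty)$, $e,p$ are defined on $[\rho_0,\infty)$ and left-continuous at the $\rho_k$, and, for each $j$, $$\dot z_j(r)=\sum_{k>j}z_k(r)+v(r)+\varphi_j(z(r)),\qquad r>r_0,\ r\notin\{\rho_k\},$$ $$\dot e_j(r)=\sum_{k>j}e_k(r)+\varphi_j\big(e(r)+z(r-\tau)\big)-\varphi_j\big(z(r-\tau)\big),\quad \dot p_j(r)=0,\qquad r>\rho_0,\ r\notin\{\rho_k\},$$ $$e_j(\rho_k^+)=e_j(\rho_k)+\tfrac14\,\mathrm{sgn}(-e_j(\rho_k))\,p_j(\rho_k),\qquad p(\rho_k^+)=\Lambda p(\rho_k),$$ with $v(r)=0$ for $r<\rho_0$ and, with $w_j(r)=e_j(r)+z_j(r-\tau)$,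 $v(r)=-\sigma_n\big(w_n(r)+\sigma_{n-1}(w_{n-1}(r)+\dots+\sigma_1(w_1(r))\dots)\big)$ for $r\ge\rho_0$, and with the initial conditions $|(\Phi^{-1}z(r_0))_j|\le\bar\ell_j$ for all $j$, $e(\rho_0)=-z(r_0)$, $p(\rho_0)=2\Phi\bar\ell$. Inductive hypothesis for the index $i$, with constants $\bar Z_i>0$ and $R_i>\max\{\tau,\rho_0\}$: $|(z_i(r),\dots,z_n(r))|\le\bar Z_i$ for all $r\ge r_0$; $|e_j(r)|\le p_j(r)/2$ for all $j\ge i$ and $r\ge\rho_0$; and for all $j\ge i$ and $r\ge R_i$, $$|z_j(r)|\le\tfrac14\varepsilon_j,\qquad |e_j(r)|\le\frac1{2n}\cdot\frac1{80^{\,j-i+2}}\,\varepsilon_j .$$ Lemma 5. Let $P\le P_m\le[20\cdot30^n n]^{-1}$ and $\tau\le\tau_m\le[6\cdot30^{n+1}n(n+1)]^{-1}$, let $i\in\{2,\dots,n\}$, and let $\Lambda_i$ be a Schur stable real matrix with rows and columns indexed by $i,\dots,n$. Given $\bar\ell$, $T_M$, $\Lambda_i$ and $\bar Z_i$, there is a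 row vector $*\in\mathbb R^{n-i+1}$ such that for all $t_0$ and $R_i$ there are $\bar Z_{i-1}$ and $R_{i-1}$ with the following property. For all transmission times as above with first time $t_0$ (and any $T_m>0$), all matrices $\Lambda$ whose rows $i-1,\dots,n$ are zero in the columns before $i-1$ and form in the columns $i-1,\dots,n$ the block $\begin{pmatrix}1/2&*\\0&\Lambda_i\end{pmatrix}$, and all trajectories of the closed-loop system: if the inductive hypothesis holds for $i$ with the constants $\bar Z_i,R_i$, then it holds for $i-1$ with the constants $\bar Z_{i-1},R_{i-1}$. -/

import Mathlib

open Filter Topology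

noncomputable section

namespace Feedforward

/-- The saturation functions `σ`: odd, `C¹`, `0 ≤ σ' ≤ 1`, equal to `1` on `[21/20, ∞)` and to the
identity on `[0, 19/20]`. -/
structure IsSaturation (σ : ℝ → ℝ) : Prop where
  odd : ∀ s, σ (-s) = -σ s
  contDiff : ContDiff ℝ 1 σ
  deriv_nonneg : ∀ s, 0 ≤ deriv σ s
  deriv_le_one : ∀ s, deriv σ s ≤ 1
  eq_one : ∀ s, 21 / 20 ≤ s → σ s = 1
  eq_self : ∀ s, 0 ≤ s → s ≤ 19 / 20 → σ s = s

/-- A real square matrix is Schur stable: all its complex eigenvalues lie strictly inside the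
unit circle. -/
def SchurStable {ι : Type} [Fintype ι] [DecidableEq ι] (A : Matrix ι ι ℝ) : Prop :=
  ∀ μ ∈ spectrum ℂ (A.map (algebraMap ℝ ℂ)), ‖μ‖ < 1

/- Coordinates are numbered `0, …, n - 1`: the index `j : Fin n` stands for the coordinate `j + 1`
of the mathematical text. -/

/-- The saturation levels: in the 1-based numbering `1 = 30 ε_n = 30² ε_{n-1} = … = 30ⁿ ε_1`. -/
def level {n : ℕ} (j : Fin n) : ℝ := 1 / 30 ^ (n - (j : ℕ))

/-- The part `(x_j, …, x_n)` of a vector, with its Euclidean norm. -/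
def tailFrom {n : ℕ} (j : Fin n) (x : Fin n → ℝ) : EuclideanSpace ℝ (Set.Ici j) :=
  WithLp.toLp 2 fun k => x k

/-- The part `(x_{j+1}, …, x_n)` of a vector, with its Euclidean norm. -/
def tailAfter {n : ℕ} (j : Fin n) (x : Fin n → ℝ) : EuclideanSpace ℝ (Set.Ioi j) :=
  WithLp.toLp 2 fun k => x k

/-- The nonlinearities `h_1, …, h_{n-1}` of the feedforward system
`ẋ_j = x_{j+1} + h_j (x_{j+1}, …, x_n)` for `j < n`, `ẋ_n = u`: they are `C²`, and
`|h_j X| ≤ M |X|²` whenever `|X|_∞ ≤ 1`.  For the last index the argument is the empty vector, so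
that the bound says that `h_n = 0`. -/
structure IsFeedforward {n : ℕ} (M : ℝ)
    (h : (j : Fin n) → EuclideanSpace ℝ (Set.Ioi j) → ℝ) : Prop where
  contDiff : ∀ j, ContDiff ℝ 2 (h j)
  bound : ∀ (j : Fin n) (X : EuclideanSpace ℝ (Set.Ioi j)),
    (∀ k, |X k| ≤ 1) → |h j X| ≤ M * ‖X‖ ^ 2

/-- The parameters: the gain `M` of the nonlinearities, the design parameters `L ≤ M` and `κ`, and
the delay `θ` of the channel. -/
structure Params where
  M : ℝ
  L : ℝ
  κ : ℝ
  θ : ℝ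

/-- The delay `τ = θ / κ` in the time scale `r = t / κ`. -/
def Params.τ (c : Params) : ℝ := c.θ / c.κ

/-- The matrix `Φ` of the change of coordinates: the row `i` of `Φ x` is `p_i` evaluated at
`((M / L) κ^{i-1} x_i, …, (M / L) κ^{n-1} x_n)`, where
`p_i (a_i, …, a_n) = ∑_{j ≥ i} (n-i)! / ((n-j)! (j-i)!) a_j`. -/
def Phi (n : ℕ) (c : Params) : Matrix (Fin n) (Fin n) ℝ := fun i j =>
  if i ≤ j then
    (Nat.choose (n - 1 - (i : ℕ)) ((j : ℕ) - (i : ℕ)) : ℝ) * (c.M / c.L * c.κ ^ (j : ℕ))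
  else 0

/-- The inverse of `Φ`: the row `i` of `Φ⁻¹ z` is `(L / (M κ^{i-1})) q_i (z_i, …, z_n)`, where
`q_i (a_i, …, a_n) = ∑_{j ≥ i} (-1)^{i+j} (n-i)! / ((n-j)! (j-i)!) a_j`. -/
def PhiInv (n : ℕ) (c : Params) : Matrix (Fin n) (Fin n) ℝ := fun i j =>
  if i ≤ j then
    c.L / (c.M * c.κ ^ (i : ℕ)) *
      ((-1) ^ ((i : ℕ) + (j : ℕ)) * (Nat.choose (n - 1 - (i : ℕ)) ((j : ℕ) - (i : ℕ)) : ℝ))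
  else 0

/-- The nonlinearity `(f_1, …, f_n)` in the coordinates `z = Φ x` and the time scale `t = κ r`: the
vector field `x ↦ (h_1 (x_2, …, x_n), …, h_{n-1} (x_n), 0)` becomes
`z ↦ κ Φ (h_j (tail of Φ⁻¹ z))_j`.  Its component `f_j` depends on `z_{j+1}, …, z_n` only. -/
def phiField {n : ℕ} (c : Params) (h : (j : Fin n) → EuclideanSpace ℝ (Set.Ioi j) → ℝ)
    (z : Fin n → ℝ) : Fin n → ℝ :=
  c.κ • (Phi n c).mulVec fun j => h j (tailAfter j ((PhiInv n c).mulVec z))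

/-- The constant `P = n³ (n!)³ L κ⁻¹`. -/
def growthConst (n : ℕ) (c : Params) : ℝ :=
  (n : ℝ) ^ 3 * (Nat.factorial n : ℝ) ^ 3 * c.L / c.κ

/-- The nested saturations `σ_k (w_k + σ_{k-1} (w_{k-1} + … + σ_1 (w_1)))`, with
`σ_k s = ε_k σ (s / ε_k)` (here `k` is the 1-based index, and the value for `k = 0` is `0`). -/
def nestedSat {n : ℕ} (σ : ℝ → ℝ) (w : Fin n → ℝ) : ℕ → ℝ
  | 0 => 0
  | k + 1 =>
      if hk : k < n then
        level ⟨k, hk⟩ * σ ((w ⟨k, hk⟩ + nestedSat σ w k) / level ⟨k, hk⟩)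
      else 0

/-- Transmission times `t_0 < t_1 < …` with `T_m ≤ t_{k+1} - t_k ≤ T_M`. -/
structure IsTransmission (t₀ Tmin Tmax : ℝ) (t : ℕ → ℝ) : Prop where
  start : t 0 = t₀
  lower : ∀ k, Tmin ≤ t (k + 1) - t k
  upper : ∀ k, t (k + 1) - t k ≤ Tmax

/-- The reset times `ρ_k = (t_k + θ) / κ`, in the time scale `r`. -/
def resetTime (c : Params) (t : ℕ → ℝ) (k : ℕ) : ℝ := (t k + c.θ) / c.κ

/-- The control in the new coordinates: it is zero until the first packet is received, at
`ρ_0`, and afterwards the nested saturated feedback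
`-σ_n (e_n(r) + z_n(r-τ) + σ_{n-1} (… + σ_1 (e_1(r) + z_1(r-τ))))`. -/
def control {n : ℕ} (c : Params) (σ : ℝ → ℝ) (t : ℕ → ℝ) (z e : ℝ → Fin n → ℝ) (r : ℝ) : ℝ :=
  if r < resetTime c t 0 then 0 else -nestedSat σ (fun j => e r j + z (r - c.τ) j) n

/-- `(z, e, p)` is a trajectory of the closed-loop impulsive delay system: `z(r) = Φ x(κ r)` is the
state of the process, defined for `r ≥ t_0 / κ`, `e(r) = Φ (ψ(κ r) - x(κ (r - τ)))` is the
quantization error, i.e. the error of the decoder, and `p` the vector of edge lengths of the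
quantization region, both defined for `r ≥ ρ_0`.  The functions `e`, `p` are continuous from the left
at the reset times, so that `e (ρ_k)` and `p (ρ_k)` are the values before the reset. -/
structure IsTrajectory {n : ℕ} (c : Params) (σ : ℝ → ℝ)
    (h : (j : Fin n) → EuclideanSpace ℝ (Set.Ioi j) → ℝ) (ℓ : Fin n → ℝ) (t : ℕ → ℝ)
    (Λ : Matrix (Fin n) (Fin n) ℝ) (z e p : ℝ → Fin n → ℝ) : Prop where
  z_cont : ContinuousOn z (Set.Ici (t 0 / c.κ))
  z_deriv : ∀ r, t 0 / c.κ < r → (∀ k, r ≠ resetTime c t k) → ∀ j : Fin n,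
    HasDerivAt (fun s => z s j)
      ((∑ k ∈ Finset.Ioi j, z r k) + control c σ t z e r + phiField c h (z r) j) r
  e_deriv : ∀ r, resetTime c t 0 < r → (∀ k, r ≠ resetTime c t k) → ∀ j : Fin n,
    HasDerivAt (fun s => e s j)
      ((∑ k ∈ Finset.Ioi j, e r k) + phiField c h (e r + z (r - c.τ)) j
        - phiField c h (z (r - c.τ)) j) r
  p_deriv : ∀ r, resetTime c t 0 < r → (∀ k, r ≠ resetTime c t k) → ∀ j : Fin n,
    HasDerivAt (fun s => p s j) 0 r
  e_left : ∀ k, ContinuousWithinAt e (Set.Icc (resetTime c t 0) (resetTime c t k))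
    (resetTime c t k)
  p_left : ∀ k, ContinuousWithinAt p (Set.Icc (resetTime c t 0) (resetTime c t k))
    (resetTime c t k)
  e_reset : ∀ k, Tendsto e (𝓝[>] (resetTime c t k))
    (𝓝 fun j => e (resetTime c t k) j
      + 1 / 4 * (Real.sign (-e (resetTime c t k) j) * p (resetTime c t k) j))
  p_reset : ∀ k, Tendsto p (𝓝[>] (resetTime c t k)) (𝓝 (Λ.mulVec (p (resetTime c t k))))
  /-- the initial state `x(t_0) = Φ⁻¹ z(t_0 / κ)` of the process satisfies `|x_j(t_0)| ≤ ℓ_j` -/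
  z_init : ∀ j, |(PhiInv n c).mulVec (z (t 0 / c.κ)) j| ≤ ℓ j
  p_init : p (resetTime c t 0) = (2 : ℝ) • (Phi n c).mulVec ℓ
  /-- the decoder starts from `ψ = 0`, that is `e(ρ_0) = -Φ x(t_0)` -/
  e_init : e (resetTime c t 0) = -z (t 0 / c.κ)

/-- The update matrix `Λ` has, in the rows and columns `m = i - 1, i, …, n`, the block form
`[[1/2, row], [0, Λi]]`, and the rows with indices `m, …, n` vanish in the columns before `m`, so that
`p_m, …, p_n` evolve autonomously.  The rows before `m` are not restricted. -/
structure HasBlockForm {n : ℕ} (m i : Fin n) (row : Set.Ici i → ℝ)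
    (Λi : Matrix (Set.Ici i) (Set.Ici i) ℝ) (Λ : Matrix (Fin n) (Fin n) ℝ) : Prop where
  corner : Λ m m = 1 / 2
  first_row : ∀ k : Set.Ici i, Λ m k = row k
  block : ∀ j k : Set.Ici i, Λ j k = Λi j k
  col_zero : ∀ j : Set.Ici i, Λ j m = 0
  left_zero : ∀ j k : Fin n, m ≤ j → k < m → Λ j k = 0

/-- The inductive hypothesis for the index `i`, with the bound `Zbar` of `|(z_i, …, z_n)|` and the
time `R`. -/
structure InductiveHyp {n : ℕ} (c : Params) (t : ℕ → ℝ) (z e p : ℝ → Fin n → ℝ) (i : Fin n)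
    (Zbar R : ℝ) : Prop where
  Zbar_pos : 0 < Zbar
  z_bounded : ∀ r, t 0 / c.κ ≤ r → ‖tailFrom i (z r)‖ ≤ Zbar
  e_le : ∀ j, i ≤ j → ∀ r, resetTime c t 0 ≤ r → |e r j| ≤ p r j / 2
  tau_lt : c.τ < R
  start_lt : resetTime c t 0 < R
  z_small : ∀ j, i ≤ j → ∀ r, R ≤ r → |z r j| ≤ 1 / 4 * level j
  e_small : ∀ j, i ≤ j → ∀ r, R ≤ r →
    |e r j| ≤ 1 / (2 * (n : ℝ)) * (1 / 80 ^ ((j : ℕ) - (i : ℕ) + 2)) * level j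

/-- `PhiInv` is the inverse of `Phi`. -/
theorem Phi_mul_PhiInv (n : ℕ) (c : Params) (hM : 0 < c.M) (hL : 0 < c.L) (hκ : 0 < c.κ) :
    Phi n c * PhiInv n c = 1 := by
  ext i k
  rw [Matrix.mul_apply, Matrix.one_apply]
  have key : ∀ j : Fin n, Phi n c i j * PhiInv n c j k =
      if i ≤ j ∧ j ≤ k then (Nat.choose (n - 1 - (i : ℕ)) ((k : ℕ) - i) : ℝ) *
        ((-1) ^ ((j : ℕ) + k) * (Nat.choose ((k : ℕ) - i) ((j : ℕ) - i) : ℝ)) else 0 := by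
    intro j
    by_cases h1 : i ≤ j
    · by_cases h2 : j ≤ k
      · have h1' : (i : ℕ) ≤ j := h1
        have h2' : (j : ℕ) ≤ k := h2
        have hk := k.isLt
        have e := Nat.choose_mul (n := n - 1 - (i : ℕ)) (k := (k : ℕ) - i) (s := (j : ℕ) - i)
          (by omega)
        have e1 : n - 1 - (i : ℕ) - ((j : ℕ) - i) = n - 1 - (j : ℕ) := by omega
        have e2 : (k : ℕ) - i - ((j : ℕ) - i) = (k : ℕ) - j := by omega
        rw [e1, e2] at e
        have e' : (Nat.choose (n - 1 - (i : ℕ)) ((k : ℕ) - i) : ℝ) *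
            (Nat.choose ((k : ℕ) - i) ((j : ℕ) - i) : ℝ) =
            (Nat.choose (n - 1 - (i : ℕ)) ((j : ℕ) - i) : ℝ) *
            (Nat.choose (n - 1 - (j : ℕ)) ((k : ℕ) - j) : ℝ) := by exact_mod_cast e
        simp only [Phi, PhiInv, h1, h2, and_self, if_true]
        have hp : c.κ ^ (j : ℕ) ≠ 0 := by positivity
        have e3 : c.M / c.L * c.κ ^ (j : ℕ) * (c.L / (c.M * c.κ ^ (j : ℕ))) = 1 := by
          field_simp
        linear_combination (Nat.choose (n - 1 - (i : ℕ)) ((j : ℕ) - i) : ℝ) *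
          (-1) ^ ((j : ℕ) + k) * (Nat.choose (n - 1 - (j : ℕ)) ((k : ℕ) - j) : ℝ) * e3 -
          (-1) ^ ((j : ℕ) + k) * e'
      · simp [PhiInv, h2]
    · simp [Phi, h1]
  rw [Finset.sum_congr rfl fun j _ => key j]
  by_cases hik : i ≤ k
  · have hik' : (i : ℕ) ≤ k := hik
    have hk := k.isLt
    let g : ℕ → ℝ := fun j => if (i : ℕ) ≤ j ∧ j ≤ k then
      (Nat.choose (n - 1 - (i : ℕ)) ((k : ℕ) - i) : ℝ) *
        ((-1) ^ (j + (k : ℕ)) * (Nat.choose ((k : ℕ) - i) (j - i) : ℝ)) else 0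
    have e1 := Fin.sum_univ_eq_sum_range g n
    have e2 : ∑ j ∈ Finset.range n, g j = ∑ j ∈ Finset.Ico (i : ℕ) (k + 1), g j := by
      symm
      apply Finset.sum_subset
      · intro x hx
        simp only [Finset.mem_Ico, Finset.mem_range] at hx ⊢
        omega
      · intro x _ hx
        simp only [Finset.mem_Ico] at hx
        exact if_neg (by omega)
    refine Eq.trans (e1.trans e2) ?_
    rw [Finset.sum_Ico_eq_sum_range]
    have e3 : ∀ s ∈ Finset.range ((k : ℕ) + 1 - i), g (i + s) =
        (Nat.choose (n - 1 - (i : ℕ)) ((k : ℕ) - i) : ℝ) * (-1) ^ ((i : ℕ) + k) *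
          ((-1) ^ s * (Nat.choose ((k : ℕ) - i) s : ℝ)) := by
      intro s hs
      rw [Finset.mem_range] at hs
      have : (i : ℕ) ≤ i + s ∧ (i : ℕ) + s ≤ k := by omega
      simp only [g, if_pos this, Nat.add_sub_cancel_left]
      ring
    rw [Finset.sum_congr rfl e3, ← Finset.mul_sum,
      show (k : ℕ) + 1 - i = ((k : ℕ) - i) + 1 by omega]
    have e4 := Int.alternating_sum_range_choose (n := (k : ℕ) - i)
    have e5 : ∑ s ∈ Finset.range ((k : ℕ) - i + 1), ((-1 : ℝ) ^ s *
        (Nat.choose ((k : ℕ) - i) s : ℝ)) = if (k : ℕ) - i = 0 then 1 else 0 := by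
      exact_mod_cast congrArg (Int.cast : ℤ → ℝ) e4
    rw [e5]
    by_cases h : i = k
    · subst h
      simp
    · have : ¬ (k : ℕ) - i = 0 := fun h0 => h (Fin.ext (by omega))
      simp [h, this]
  · have h : i ≠ k := fun h => hik h.le
    rw [if_neg h]
    exact Finset.sum_eq_zero fun j _ => if_neg fun hj => hik (hj.1.trans hj.2)

end Feedforward

end

/-! Write `m` for the index one below `i`. Two facts carry the induction step.

The decoder error. Since the rows from `m` on vanish in the columns before `m`, the edge lengths
p_m, …, p_n evolve by themselves, and their values at the resets are determined by ℓ, `Λi` and the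
chosen row. A reset moves e_m by a quarter of the edge towards 0, so |e_m| ≤ p_m/2 becomes |e_m| ≤
p_m/4. Until the next reset e_m drifts at a rate at most (1 + K) ∑_{k>m} |e_k|, where K is a
Lipschitz constant of the nonlinearity on the bounded set given by the hypothesis for `i`. With
|e_k| ≤ p_k/2, a row that adds (1 + K) times the maximal reset interval times the sum of the updated
later edges to p_m/2 exactly absorbs this drift. The scalar recursion for p_m is then a contraction
with factor 1/2 driven by powers of a Schur stable matrix, so all these edges, and with them the
errors, tend to 0 along a sequence fixed in advance (`exists_row_forall_abs_le`).

The state. Up to a fixed time, z_m grows at most linearly. After that, the later components, the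
errors and the changes over one delay are small, so the saturations outside the one at `m` act as
the identity. Their linear terms cancel ∑_{k>m} z_k up to small errors, leaving ż_m = -σ_m(z_m + b)
+ d with b and d small relative to ε_m (`exists_saturated_form`). Hence |z_m| decreases at a rate at
least ε_m/10 while it exceeds ε_m/4; it enters that band within a time that depends only on its
initial bound and stays there (`le_max_of_deriv_le_of_above`).

The resets are locally finite because consecutive ones are separated by a positive gap. No constant
depends on the size of this gap. -/

namespace Feedforward

/-! ### Growth estimates from derivative bounds -/

/-- A function that is continuous on `[a, b]` and whose derivative is at most `C` outside a set with
finitely many points in `(a, b)` grows at most with the rate `C`. -/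
theorem sub_le_mul_of_deriv_le_off_finite {f : ℝ → ℝ} {C : ℝ} {S : Set ℝ} {a b : ℝ}
    (hab : a ≤ b) (hS : (S ∩ Set.Ioo a b).Finite) (hf : ContinuousOn f (Set.Icc a b))
    (hd : ∀ x ∈ Set.Ioo a b, x ∉ S → ∃ d ≤ C, HasDerivAt f d x) :
    f b - f a ≤ C * (b - a) := by
  -- The interval is generalized because the induction on the exceptional points splits it at each
  -- new point.
  have key : ∀ (T : Finset ℝ) (a b : ℝ), a ≤ b → ContinuousOn f (Set.Icc a b) →
      (∀ x ∈ Set.Ioo a b, x ∉ T → ∃ d ≤ C, HasDerivAt f d x) →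
      f b - f a ≤ C * (b - a) := by
    intro T
    induction T using Finset.induction_on with
    | empty =>
      intro a b hab hf hd
      rcases hab.eq_or_lt with rfl | hab
      · simp
      have hd' : ∀ x ∈ Set.Ioo a b, HasDerivAt f (deriv f x) x := fun x hx => by
        obtain ⟨d, -, h⟩ := hd x hx (by simp)
        exact h.differentiableAt.hasDerivAt
      obtain ⟨x, hx, he⟩ := exists_hasDerivAt_eq_slope f (deriv f) hab hf hd'
      obtain ⟨d, hdC, h⟩ := hd x hx (by simp)
      rw [h.deriv, eq_div_iff (by linarith)] at he
      rw [← he]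
      exact mul_le_mul_of_nonneg_right hdC (by linarith)
    | insert s T _ ih =>
      intro a b hab hf hd
      by_cases hs : s ∈ Set.Ioo a b
      · have h1 := ih a s hs.1.le (hf.mono (Set.Icc_subset_Icc_right hs.2.le))
          fun x hx hxT => hd x ⟨hx.1, hx.2.trans hs.2⟩ (by simp [hx.2.ne, hxT])
        have h2 := ih s b hs.2.le (hf.mono (Set.Icc_subset_Icc_left hs.1.le))
          fun x hx hxT => hd x ⟨hs.1.trans hx.1, hx.2⟩ (by simp [hx.1.ne', hxT])
        linarith
      · refine ih a b hab hf fun x hx hxT => hd x hx ?_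
        rw [Finset.mem_insert, not_or]
        exact ⟨fun e => hs (e ▸ hx), hxT⟩
  refine key hS.toFinset a b hab hf fun x hx hxT => hd x hx fun hxS => hxT ?_
  simpa using ⟨hxS, hx⟩

theorem abs_sub_le_mul_of_abs_deriv_le_off_finite {f : ℝ → ℝ} {C : ℝ} {S : Set ℝ} {a b : ℝ}
    (hab : a ≤ b) (hS : (S ∩ Set.Ioo a b).Finite) (hf : ContinuousOn f (Set.Icc a b))
    (hd : ∀ x ∈ Set.Ioo a b, x ∉ S → ∃ d, |d| ≤ C ∧ HasDerivAt f d x) :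
    |f b - f a| ≤ C * (b - a) := by
  have h1 := sub_le_mul_of_deriv_le_off_finite hab hS hf fun x hx hxS => by
    obtain ⟨d, h1, h2⟩ := hd x hx hxS
    exact ⟨d, (abs_le.1 h1).2, h2⟩
  have h2 := sub_le_mul_of_deriv_le_off_finite (f := fun x => -f x) hab hS hf.neg
    fun x hx hxS => by
      obtain ⟨d, h1, h2⟩ := hd x hx hxS
      exact ⟨-d, by linarith [(abs_le.1 h1).1], h2.neg⟩
  rw [abs_le]
  constructor <;> linarith

/-- A function that decreases at least with the rate `c` as long as it is above `α` ends up
below `α`. -/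
theorem le_max_of_deriv_le_of_above {f : ℝ → ℝ} {c α : ℝ} {S : Set ℝ} {a b : ℝ}
    (hc : 0 ≤ c) (hab : a ≤ b) (hS : (S ∩ Set.Ioo a b).Finite)
    (hf : ContinuousOn f (Set.Icc a b))
    (hd : ∀ x ∈ Set.Ioo a b, x ∉ S → α < f x → ∃ d ≤ -c, HasDerivAt f d x) :
    f b ≤ max α (f a - c * (b - a)) := by
  by_contra! hlt
  obtain ⟨h1, h2⟩ := max_lt_iff.1 hlt
  -- After the last time in `K` the function is above `α` and hence does not increase, so it could
  -- not end above `α`. If `K` is empty, it decreases on the whole interval.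
  let K := {x ∈ Set.Icc a b | f x ≤ α}
  by_cases hK : K.Nonempty
  · have hKc : IsCompact K := by
      have : IsClosed K := hf.preimage_isClosed_of_isClosed isClosed_Icc isClosed_Iic
      exact isCompact_Icc.of_isClosed_subset this fun x hx => hx.1
    obtain ⟨s, hs⟩ := hKc.exists_isGreatest hK
    have hsab := hs.1.1
    have := sub_le_mul_of_deriv_le_off_finite (f := f) (C := -c) (S := S) hsab.2
      (hS.subset fun x hx => ⟨hx.1, hsab.1.trans_lt hx.2.1, hx.2.2⟩)
      (hf.mono (Set.Icc_subset_Icc_left hsab.1)) fun x hx hxS => by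
        refine hd x ⟨hsab.1.trans_lt hx.1, hx.2⟩ hxS ?_
        by_contra! h
        exact absurd (hs.2 ⟨⟨hsab.1.trans hx.1.le, hx.2.le⟩, h⟩) (not_le.2 hx.1)
    have h3 : 0 ≤ c * (b - s) := mul_nonneg hc (by linarith [hsab.2])
    have h4 : f s ≤ α := hs.1.2
    linarith
  · have := sub_le_mul_of_deriv_le_off_finite (f := f) (C := -c) hab hS hf fun x hx hxS => by
        refine hd x hx hxS ?_
        by_contra! h
        exact hK ⟨x, ⟨hx.1.le, hx.2.le⟩, h⟩
    linarith

/-! ### Schur stable matrices and contracting recursions -/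

section
attribute [local instance] Matrix.linftyOpNormedRing Matrix.linftyOpNormedAlgebra

/-- The powers of a Schur stable matrix tend to zero. -/
theorem SchurStable.tendsto_pow {ι : Type} [Fintype ι] [DecidableEq ι] {A : Matrix ι ι ℝ}
    (hA : SchurStable A) : Tendsto (fun k : ℕ => A ^ k) atTop (𝓝 0) := by
  rcases isEmpty_or_nonempty ι with hι | hι
  · exact tendsto_const_nhds.congr fun k => Subsingleton.elim _ _
  let B : Matrix ι ι ℂ := A.map (algebraMap ℝ ℂ)
  have hB : Tendsto (fun k : ℕ => B ^ k) atTop (𝓝 0) := by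
    have : CompleteSpace (Matrix ι ι ℂ) := FiniteDimensional.complete ℂ _
    -- By Gelfand's formula, any r strictly between the spectral radius and 1 gives ‖B ^ k‖ ≤ r ^ k
    -- for large k.
    have h1 : spectralRadius ℂ B < 1 :=
      spectrum.spectralRadius_lt_of_forall_lt B (r := 1) fun μ hμ => by
        have := hA μ hμ
        exact_mod_cast this
    obtain ⟨r, hr1, hr2⟩ := ENNReal.lt_iff_exists_nnreal_btwn.1 h1
    have h2 := (spectrum.pow_nnnorm_pow_one_div_tendsto_nhds_spectralRadius B).eventually
      (gt_mem_nhds hr1)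
    refine tendsto_zero_iff_norm_tendsto_zero.2 ?_
    have hr3 : (r : ℝ) < 1 := by exact_mod_cast hr2
    refine squeeze_zero' (Eventually.of_forall fun _ => norm_nonneg _) ?_
      (tendsto_pow_atTop_nhds_zero_of_lt_one r.coe_nonneg hr3)
    filter_upwards [h2, eventually_gt_atTop 0] with k hk hk0
    have hk0' : (0 : ℝ) < k := by exact_mod_cast hk0
    have h3 := ENNReal.rpow_le_rpow hk.le hk0'.le
    rw [← ENNReal.rpow_mul, one_div_mul_cancel hk0'.ne', ENNReal.rpow_one,
      ENNReal.rpow_natCast] at h3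
    exact_mod_cast h3
  refine tendsto_pi_nhds.2 fun i => tendsto_pi_nhds.2 fun j => ?_
  have h := (Complex.continuous_re.tendsto _).comp
    (tendsto_pi_nhds.1 (tendsto_pi_nhds.1 hB i) j)
  refine h.congr fun k => ?_
  have : B ^ k = (A ^ k).map (algebraMap ℝ ℂ) := by
    have := map_pow (RingHom.mapMatrix (m := ι) (algebraMap ℝ ℂ)) A k
    simpa [B] using this.symm
  simp [this]

end

theorem SchurStable.tendsto_pow_mulVec {ι : Type} [Fintype ι] [DecidableEq ι] {A : Matrix ι ι ℝ}
    (hA : SchurStable A) (v : ι → ℝ) :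
    Tendsto (fun k : ℕ => (A ^ k).mulVec v) atTop (𝓝 0) := by
  have : Continuous fun B : Matrix ι ι ℝ => B.mulVec v := by fun_prop
  have h := (this.tendsto 0).comp hA.tendsto_pow
  rw [Matrix.zero_mulVec] at h
  exact h

/-- The solutions of `a (k + 1) = a k / 2 + b k` tend to zero if `b` does. -/
theorem tendsto_zero_of_half_add {a b : ℕ → ℝ} (h : ∀ k, a (k + 1) = 1 / 2 * a k + b k)
    (hb : Tendsto b atTop (𝓝 0)) : Tendsto a atTop (𝓝 0) := by
  rw [Metric.tendsto_atTop] at hb ⊢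
  intro ε hε
  obtain ⟨N, hN⟩ := hb (ε / 4) (by positivity)
  -- ε/2 is the fixed point of x ↦ x/2 + ε/4.
  have h1 : ∀ k, |a (N + k)| ≤ |a N| * (1 / 2) ^ k + ε / 2 := by
    intro k
    induction k with
    | zero => simp; positivity
    | succ k ih =>
      have h2 := hN (N + k) (by omega)
      rw [Real.dist_0_eq_abs] at h2
      rw [← add_assoc, h]
      calc |1 / 2 * a (N + k) + b (N + k)| ≤ |1 / 2 * a (N + k)| + |b (N + k)| := abs_add_le _ _
        _ = 1 / 2 * |a (N + k)| + |b (N + k)| := by rw [abs_mul]; norm_num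
        _ ≤ _ := by rw [pow_succ]; linarith
  have h3 : Tendsto (fun k : ℕ => |a N| * (1 / 2) ^ k) atTop (𝓝 0) := by
    simpa using (tendsto_pow_atTop_nhds_zero_of_lt_one (by norm_num : (0 : ℝ) ≤ 1 / 2)
      (by norm_num)).const_mul |a N|
  obtain ⟨N', hN'⟩ := (h3.eventually (gt_mem_nhds (show (0 : ℝ) < ε / 2 by
    positivity))).exists_forall_of_atTop
  refine ⟨N + N', fun k hk => ?_⟩
  obtain ⟨k, rfl⟩ := Nat.exists_eq_add_of_le (show N ≤ k by omega)
  rw [Real.dist_0_eq_abs]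
  linarith [h1 k, hN' k (by omega)]

/-! ### Saturations and their nesting -/

theorem IsSaturation.monotone {σ : ℝ → ℝ} (hσ : IsSaturation σ) : Monotone σ :=
  monotone_of_deriv_nonneg (hσ.contDiff.differentiable one_ne_zero) hσ.deriv_nonneg

theorem IsSaturation.abs_le_one {σ : ℝ → ℝ} (hσ : IsSaturation σ) (s : ℝ) : |σ s| ≤ 1 := by
  have key : ∀ s, σ s ≤ 1 := fun s => by
    rw [← hσ.eq_one (max s (21 / 20)) (le_max_right _ _)]
    exact hσ.monotone (le_max_left _ _)
  rw [abs_le]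
  have := key (-s)
  rw [hσ.odd] at this
  exact ⟨by linarith, key s⟩

theorem IsSaturation.eq_self_of_abs_le {σ : ℝ → ℝ} (hσ : IsSaturation σ) {s : ℝ}
    (hs : |s| ≤ 19 / 20) : σ s = s := by
  rcases abs_le.1 hs with ⟨h1, h2⟩
  rcases le_total 0 s with h | h
  · exact hσ.eq_self s h h2
  · have := hσ.eq_self (-s) (by linarith) (by linarith)
    rw [hσ.odd] at this
    linarith

variable {n : ℕ}

theorem level_pos (j : Fin n) : 0 < level j := by
  unfold level
  positivity

theorem le_level (j : Fin n) : 1 / 30 ^ n ≤ level j := by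
  unfold level
  gcongr
  · norm_num
  · omega

/-- The levels are a partial geometric series with ratio 1/30, uniformly in the dimension. -/
theorem sum_level_le : ∑ j : Fin n, level j ≤ 1 / 29 := by
  have h : ∀ n : ℕ, ∑ j ∈ Finset.range n, (1 : ℝ) / 30 ^ (n - j) ≤ 1 / 29 := by
    intro n
    induction n with
    | zero => norm_num
    | succ n ih =>
      rw [Finset.sum_range_succ]
      have : ∑ j ∈ Finset.range n, (1 : ℝ) / 30 ^ (n + 1 - j) =
          1 / 30 * ∑ j ∈ Finset.range n, (1 : ℝ) / 30 ^ (n - j) := by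
        rw [Finset.mul_sum]
        refine Finset.sum_congr rfl fun j hj => ?_
        rw [Finset.mem_range] at hj
        rw [show n + 1 - j = (n - j) + 1 by omega, pow_succ]
        field_simp
      rw [this, show n + 1 - n = 1 by omega]
      linarith
  calc ∑ j : Fin n, level j = ∑ j ∈ Finset.range n, (1 : ℝ) / 30 ^ (n - j) :=
        Fin.sum_univ_eq_sum_range (fun j => (1 : ℝ) / 30 ^ (n - j)) n
    _ ≤ 1 / 29 := h n

theorem nestedSat_succ (σ : ℝ → ℝ) (w : Fin n → ℝ) (k : Fin n) :
    nestedSat σ w (k + 1) = level k * σ ((w k + nestedSat σ w k) / level k) := by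
  simp [nestedSat]

theorem abs_nestedSat_succ_le {σ : ℝ → ℝ} (hσ : IsSaturation σ) (w : Fin n → ℝ) (k : Fin n) :
    |nestedSat σ w (k + 1)| ≤ level k := by
  rw [nestedSat_succ, abs_mul, abs_of_pos (level_pos k)]
  exact mul_le_of_le_one_right (level_pos k).le (hσ.abs_le_one _)

/-- Each saturation level is 1/30 of the next one, so for k < n the inner value is at most a
thirtieth of the level at which it is used. The case k = n bounds the whole feedback. -/
theorem abs_nestedSat_le {σ : ℝ → ℝ} (hσ : IsSaturation σ) (w : Fin n → ℝ) {k : ℕ} (hk : k ≤ n) :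
    |nestedSat σ w k| ≤ 1 / 30 ^ (n - k) / 30 := by
  rcases k with _ | k
  · rw [nestedSat, abs_zero]
    positivity
  · refine (abs_nestedSat_succ_le hσ w ⟨k, hk⟩).trans_eq ?_
    rw [level, show n - k = n - (k + 1) + 1 by omega, pow_succ]
    field_simp

/-- Where the arguments are small, the outer saturations act as the identity. -/
theorem nestedSat_eq_sum_add {σ : ℝ → ℝ} (hσ : IsSaturation σ) {w : Fin n → ℝ} {m : Fin n}
    (hw : ∀ j, m < j → |w j| ≤ level j / 2) :
    nestedSat σ w n = ∑ k ∈ Finset.Ioi m, w k + nestedSat σ w (m + 1) := by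
  have key : ∀ k : ℕ, (m : ℕ) + 1 ≤ k → k ≤ n → nestedSat σ w k =
      ∑ j ∈ (Finset.Ioi m).filter (fun j : Fin n => (j : ℕ) < k), w j + nestedSat σ w (m + 1) := by
    intro k hk
    induction k, hk using Nat.le_induction with
    | base =>
      intro _
      rw [Finset.sum_eq_zero, zero_add]
      intro j hj
      rw [Finset.mem_filter, Finset.mem_Ioi, Fin.lt_def] at hj
      omega
    | succ k hmk ih =>
      intro hk
      let k' : Fin n := ⟨k, hk⟩
      have hmk' : m < k' := by
        rw [Fin.lt_def]
        exact hmk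
      have h1 : nestedSat σ w (k + 1) = w k' + nestedSat σ w k := by
        rw [show k = (k' : ℕ) from rfl, nestedSat_succ, hσ.eq_self_of_abs_le]
        · field_simp [(level_pos k').ne']
        -- Relative to the level, the argument is at most 1/2 + 1/30 < 19/20, inside the linear
        -- zone.
        · have h2 := abs_nestedSat_le hσ w (show k ≤ n by omega)
          have h3 := hw k' hmk'
          have h4 := level_pos k'
          have h5 : level k' = 1 / 30 ^ (n - k) := rfl
          rw [← h5] at h2
          rw [abs_div, abs_of_pos h4, div_le_iff₀ h4]
          refine (abs_add_le _ _).trans ?_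
          change |w k'| + |nestedSat σ w k| ≤ _
          linarith
      have h6 : (Finset.Ioi m).filter (fun j : Fin n => (j : ℕ) < k + 1) =
          insert k' ((Finset.Ioi m).filter (fun j : Fin n => (j : ℕ) < k)) := by
        ext j
        simp only [Finset.mem_filter, Finset.mem_Ioi, Finset.mem_insert, Fin.ext_iff, Fin.lt_def]
        simp only [Fin.lt_def] at hmk'
        change _ ↔ (j : ℕ) = k ∨ _
        omega
      rw [h1, ih (by omega), h6, Finset.sum_insert (by simp [k'])]
      ring
  rw [key n (by omega) le_rfl, Finset.filter_true_of_mem fun j _ => j.isLt]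

/-! ### The change of coordinates and the nonlinearity -/

theorem choose_le_factorial_of_le {a b N : ℕ} (h : a ≤ N) : a.choose b ≤ N.factorial := by
  refine le_trans ?_ (Nat.factorial_le h)
  rcases le_or_gt b a with hb | hb
  · rw [← Nat.choose_mul_factorial_mul_factorial hb, mul_assoc]
    exact Nat.le_mul_of_pos_right _ (by positivity)
  · simp [Nat.choose_eq_zero_of_lt hb]

theorem Phi_nonneg (c : Params) (hM : 0 ≤ c.M) (hL : 0 ≤ c.L) (hκ : 0 ≤ c.κ) (j k : Fin n) :
    0 ≤ Phi n c j k := by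
  unfold Phi
  split_ifs <;> positivity

/-- The bound of `z = Φ x` by a bound `ℓ` of `x = Φ⁻¹ z`. -/
theorem abs_le_Phi_mulVec (c : Params) (hM : 0 < c.M) (hL : 0 < c.L) (hκ : 0 < c.κ)
    {z ℓ : Fin n → ℝ} (hz : ∀ j, |(PhiInv n c).mulVec z j| ≤ ℓ j) (j : Fin n) :
    |z j| ≤ (Phi n c).mulVec ℓ j := by
  have h1 : z = (Phi n c).mulVec ((PhiInv n c).mulVec z) := by
    rw [Matrix.mulVec_mulVec, Phi_mul_PhiInv n c hM hL hκ, Matrix.one_mulVec]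
  calc |z j| = |∑ k, Phi n c j k * (PhiInv n c).mulVec z k| := congrArg abs (congrFun h1 j)
    _ ≤ ∑ k, |Phi n c j k * (PhiInv n c).mulVec z k| := Finset.abs_sum_le_sum_abs _ _
    _ ≤ ∑ k, Phi n c j k * ℓ k := by
      refine Finset.sum_le_sum fun k _ => ?_
      rw [abs_mul, abs_of_nonneg (Phi_nonneg c hM.le hL.le hκ.le j k)]
      exact mul_le_mul_of_nonneg_left (hz k) (Phi_nonneg c hM.le hL.le hκ.le j k)

theorem PhiInv_mulVec_congr (c : Params) {k : Fin n} {y z : Fin n → ℝ}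
    (hyz : ∀ l, k ≤ l → y l = z l) : (PhiInv n c).mulVec y k = (PhiInv n c).mulVec z k := by
  change ∑ l, PhiInv n c k l * y l = ∑ l, PhiInv n c k l * z l
  refine Finset.sum_congr rfl fun l _ => ?_
  by_cases hl : k ≤ l
  · rw [hyz l hl]
  · simp [PhiInv, hl]

theorem phiField_apply (c : Params) (h : (j : Fin n) → EuclideanSpace ℝ (Set.Ioi j) → ℝ)
    (z : Fin n → ℝ) (m : Fin n) : phiField c h z m =
      c.κ * ∑ j, Phi n c m j * h j (tailAfter j ((PhiInv n c).mulVec z)) := rfl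

/-- The component `m` of the nonlinearity depends on the coordinates after `m` only. -/
theorem phiField_congr (c : Params) (h : (j : Fin n) → EuclideanSpace ℝ (Set.Ioi j) → ℝ)
    {m : Fin n} {y z : Fin n → ℝ} (hyz : ∀ l, m < l → y l = z l) :
    phiField c h y m = phiField c h z m := by
  rw [phiField_apply, phiField_apply]
  congr 1
  refine Finset.sum_congr rfl fun j _ => ?_
  by_cases hj : m ≤ j
  · congr 2
    refine (WithLp.ofLp_injective 2) (funext fun k => ?_)
    exact PhiInv_mulVec_congr c fun l hl => hyz l (hj.trans_lt (lt_of_lt_of_le k.2 hl))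
  · simp [Phi, hj]

theorem contDiff_phiField (c : Params) {h : (j : Fin n) → EuclideanSpace ℝ (Set.Ioi j) → ℝ}
    (hh : IsFeedforward c.M h) (m : Fin n) : ContDiff ℝ 2 fun z => phiField c h z m := by
  simp only [phiField_apply]
  refine contDiff_const.mul (ContDiff.sum fun j _ => contDiff_const.mul ((hh.contDiff j).comp ?_))
  refine (PiLp.contDiff_toLp (p := 2)).comp (contDiff_pi.2 fun k => ?_)
  simp only [Matrix.mulVec, dotProduct]
  fun_prop

theorem abs_PhiInv_mulVec_le (c : Params) (hM : 0 < c.M) (hL : 0 < c.L) (hκ : 0 < c.κ)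
    {m k : Fin n} (hmk : m < k) (z : Fin n → ℝ) :
    |(PhiInv n c).mulVec z k| ≤
      c.L / (c.M * c.κ ^ (k : ℕ)) * (n.factorial * ∑ l ∈ Finset.Ioi m, |z l|) := by
  have h1 : (PhiInv n c).mulVec z k = ∑ l ∈ Finset.Ioi m, PhiInv n c k l * z l := by
    symm
    refine Finset.sum_subset (Finset.subset_univ _) fun l _ hl => ?_
    rw [Finset.mem_Ioi, not_lt] at hl
    simp [PhiInv, not_le.2 (hl.trans_lt hmk)]
  rw [h1, Finset.mul_sum, Finset.mul_sum]
  refine (Finset.abs_sum_le_sum_abs _ _).trans (Finset.sum_le_sum fun l _ => ?_)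
  rw [abs_mul, ← mul_assoc]
  refine mul_le_mul_of_nonneg_right ?_ (abs_nonneg _)
  unfold PhiInv
  split_ifs
  · rw [abs_mul, abs_mul, abs_pow, abs_neg, abs_one, one_pow, one_mul,
      abs_of_nonneg (by positivity), Nat.abs_cast]
    refine mul_le_mul_of_nonneg_left ?_ (by positivity)
    exact_mod_cast choose_le_factorial_of_le (by omega)
  · rw [abs_zero]
    positivity

/-- The nonlinearity is quadratically small near the origin. -/
theorem abs_phiField_le (c : Params) (hL : 0 < c.L) (hLM : c.L ≤ c.M) (hκ : 1 ≤ c.κ)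
    (hLκ : c.L ≤ c.M * c.κ / (Nat.factorial (n + 1) : ℝ))
    {h : (j : Fin n) → EuclideanSpace ℝ (Set.Ioi j) → ℝ} (hh : IsFeedforward c.M h)
    (m : Fin n) (z : Fin n → ℝ) (hz : ∑ l ∈ Finset.Ioi m, |z l| ≤ 1) :
    |phiField c h z m| ≤ growthConst n c * (∑ l ∈ Finset.Ioi m, |z l|) ^ 2 := by
  have hM : 0 < c.M := hL.trans_le hLM
  have hκ0 : 0 < c.κ := by linarith
  have hn : (1 : ℝ) ≤ n := by
    have := m.isLt
    exact_mod_cast (show 1 ≤ n by omega)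
  set S := ∑ l ∈ Finset.Ioi m, |z l| with hS
  have hS0 : 0 ≤ S := Finset.sum_nonneg fun _ _ => abs_nonneg _
  have hf : (0 : ℝ) < n.factorial := by exact_mod_cast n.factorial_pos
  have hx : ∀ j k : Fin n, m ≤ j → j < k →
      |(PhiInv n c).mulVec z k| ≤ c.L / (c.M * c.κ ^ ((j : ℕ) + 1)) * (n.factorial * S) := by
    intro j k hj hk
    refine (abs_PhiInv_mulVec_le c hM hL hκ0 (hj.trans_lt hk) z).trans ?_
    rw [← hS]
    have : (j : ℕ) + 1 ≤ k := hk
    gcongr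
  -- The smallness of L against M κ / (n+1)! keeps the relevant coordinates of x in the unit box,
  -- where the quadratic bound on h holds.
  have hx1 : ∀ j k : Fin n, m ≤ j → j < k → |(PhiInv n c).mulVec z k| ≤ 1 := by
    intro j k hj hk
    refine (hx j k hj hk).trans ?_
    have h1 : c.M * c.κ ≤ c.M * c.κ ^ ((j : ℕ) + 1) :=
      mul_le_mul_of_nonneg_left (le_self_pow₀ hκ (by omega)) hM.le
    have h2 : c.L * n.factorial ≤ c.M * c.κ := by
      rw [le_div_iff₀ (by positivity)] at hLκ
      refine le_trans (mul_le_mul_of_nonneg_left ?_ hL.le) hLκ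
      exact_mod_cast Nat.factorial_le (Nat.le_succ n)
    rw [div_mul_eq_mul_div, div_le_one (by positivity)]
    calc c.L * (n.factorial * S) ≤ c.L * (n.factorial * 1) := by gcongr
      _ ≤ _ := by linarith
  have hterm : ∀ j, c.κ * |Phi n c m j * h j (tailAfter j ((PhiInv n c).mulVec z))| ≤
      n * (n.factorial : ℝ) ^ 3 * c.L / c.κ * S ^ 2 := by
    intro j
    by_cases hj : m ≤ j
    · have h1 : |h j (tailAfter j ((PhiInv n c).mulVec z))| ≤
          c.M * (n * (c.L / (c.M * c.κ ^ ((j : ℕ) + 1)) * (n.factorial * S)) ^ 2) := by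
        refine (hh.bound j _ fun k => hx1 j k hj k.2).trans ?_
        refine mul_le_mul_of_nonneg_left ?_ hM.le
        rw [EuclideanSpace.norm_sq_eq]
        refine (Finset.sum_le_card_nsmul _ _
          ((c.L / (c.M * c.κ ^ ((j : ℕ) + 1)) * (n.factorial * S)) ^ 2) fun k _ => ?_).trans ?_
        · rw [Real.norm_eq_abs]
          exact pow_le_pow_left₀ (abs_nonneg _) (hx j k hj k.2) 2
        · rw [nsmul_eq_mul]
          refine mul_le_mul_of_nonneg_right ?_ (sq_nonneg _)
          have := Fintype.card_subtype_le (fun k : Fin n => k ∈ Set.Ioi j)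
          rw [Fintype.card_fin] at this
          exact_mod_cast this
      have h2 : |Phi n c m j| ≤ n.factorial * (c.M / c.L * c.κ ^ (j : ℕ)) := by
        rw [abs_of_nonneg (Phi_nonneg c hM.le hL.le hκ0.le m j), Phi, if_pos hj]
        refine mul_le_mul_of_nonneg_right ?_ (by positivity)
        exact_mod_cast choose_le_factorial_of_le (by omega)
      rw [abs_mul]
      -- The scaling balances: h_j only sees coordinates after j, each carrying κ^{-(j+1)}, so κ ·
      -- κ^j · κ^{-2(j+1)} = κ^{-(j+1)}, while (M/L) · M · (L/M)² = L.
      calc _ ≤ c.κ * ((n.factorial * (c.M / c.L * c.κ ^ (j : ℕ))) *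
            (c.M * (n * (c.L / (c.M * c.κ ^ ((j : ℕ) + 1)) * (n.factorial * S)) ^ 2))) := by
            gcongr
        _ = n * (n.factorial : ℝ) ^ 3 * c.L / c.κ ^ ((j : ℕ) + 1) * S ^ 2 := by
            field_simp
            ring
        _ ≤ _ := by
            gcongr
            exact le_self_pow₀ hκ (by omega)
    · have : Phi n c m j = 0 := if_neg hj
      rw [this, zero_mul, abs_zero, mul_zero]
      positivity
  rw [phiField_apply, abs_mul, abs_of_pos hκ0]
  calc c.κ * |∑ j, Phi n c m j * h j (tailAfter j ((PhiInv n c).mulVec z))|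
      ≤ c.κ * ∑ j, |Phi n c m j * h j (tailAfter j ((PhiInv n c).mulVec z))| := by
        gcongr
        exact Finset.abs_sum_le_sum_abs _ _
    _ ≤ ∑ _j : Fin n, n * (n.factorial : ℝ) ^ 3 * c.L / c.κ * S ^ 2 := by
        rw [Finset.mul_sum]
        exact Finset.sum_le_sum fun j _ => hterm j
    _ = n ^ 2 * (n.factorial : ℝ) ^ 3 * c.L / c.κ * S ^ 2 := by
        rw [Finset.sum_const, Finset.card_univ, Fintype.card_fin, nsmul_eq_mul]
        ring
    _ ≤ growthConst n c * S ^ 2 := by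
        unfold growthConst
        gcongr
        norm_num

/-- The part of the nonlinearity in the component `m` is Lipschitz on bounded sets of the
coordinates after `m`. -/
theorem exists_lipschitz_phiField (c : Params)
    {h : (j : Fin n) → EuclideanSpace ℝ (Set.Ioi j) → ℝ} (hh : IsFeedforward c.M h)
    (m : Fin n) (B : ℝ) : ∃ K : ℝ, 0 ≤ K ∧ ∀ y z : Fin n → ℝ,
      (∀ k, m < k → |y k| ≤ B) → (∀ k, m < k → |z k| ≤ B) →
      |phiField c h y m - phiField c h z m| ≤ K * ∑ k ∈ Finset.Ioi m, |y k - z k| := by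
  -- Erasing the coordinates up to `m`, which may be unbounded, leaves the component `m` unchanged
  -- and puts the points in a compact ball.
  let proj : (Fin n → ℝ) → Fin n → ℝ := fun z k => if m < k then z k else 0
  have hproj : ∀ z, phiField c h (proj z) m = phiField c h z m := fun z =>
    phiField_congr c h fun l hl => if_pos hl
  obtain ⟨K, hK⟩ := ContDiffOn.exists_lipschitzOnWith
    (s := Metric.closedBall (0 : Fin n → ℝ) |B|)
    (contDiff_phiField c hh m).contDiffOn two_ne_zero (convex_closedBall _ _)
    (isCompact_closedBall _ _)
  have hmem : ∀ z : Fin n → ℝ, (∀ k, m < k → |z k| ≤ B) →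
      proj z ∈ Metric.closedBall (0 : Fin n → ℝ) |B| := by
    intro z hz
    rw [mem_closedBall_zero_iff, pi_norm_le_iff_of_nonneg (abs_nonneg _)]
    intro k
    by_cases hk : m < k
    · simpa [proj, hk] using (hz k hk).trans (le_abs_self B)
    · simp [proj, hk]
  refine ⟨K, K.coe_nonneg, fun y z hy hz => ?_⟩
  have h1 := hK.dist_le_mul _ (hmem y hy) _ (hmem z hz)
  rw [hproj, hproj, Real.dist_eq] at h1
  refine h1.trans (mul_le_mul_of_nonneg_left ?_ K.coe_nonneg)
  rw [dist_pi_le_iff (Finset.sum_nonneg fun _ _ => abs_nonneg _)]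
  intro k
  by_cases hk : m < k
  · simp only [proj, hk, if_true, Real.dist_eq]
    exact Finset.single_le_sum (f := fun k => |y k - z k|) (fun _ _ => abs_nonneg _)
      (Finset.mem_Ioi.2 hk)
  · simpa [proj, hk] using Finset.sum_nonneg fun _ _ => abs_nonneg _

/-! ### Jumps and reset times -/

/-- A function on `(a, b]` whose derivative is at most `C` differs from its right limit `y` at `a`
by at most `C (r - a)`. -/
theorem abs_sub_le_of_tendsto_right {g : ℝ → ℝ} {a b C y r : ℝ}
    (hlim : Tendsto g (𝓝[>] a) (𝓝 y)) (hb : ContinuousWithinAt g (Set.Ioc a b) b)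
    (hd : ∀ x ∈ Set.Ioo a b, ∃ d, |d| ≤ C ∧ HasDerivAt g d x) (hr : r ∈ Set.Ioc a b) :
    |g r - y| ≤ C * (r - a) := by
  have hcont : ContinuousOn g (Set.Ioc a b) := by
    intro x hx
    rcases hx.2.lt_or_eq with h | rfl
    · obtain ⟨d, -, h⟩ := hd x ⟨hx.1, h⟩
      exact h.continuousAt.continuousWithinAt
    · exact hb
  have h1 : ∀ s ∈ Set.Ioo a r, |g r - g s| ≤ C * (r - s) := fun s hs =>
    abs_sub_le_mul_of_abs_deriv_le_off_finite (S := ∅) hs.2.le (by simp)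
      (hcont.mono fun x hx => ⟨hs.1.trans_le hx.1, hx.2.trans hr.2⟩)
      fun x hx _ => hd x ⟨hs.1.trans hx.1, hx.2.trans_le hr.2⟩
  have h2 : Tendsto (fun s => |g r - g s|) (𝓝[>] a) (𝓝 |g r - y|) :=
    (tendsto_const_nhds.sub hlim).abs
  have h3 : Tendsto (fun s => C * (r - s)) (𝓝[>] a) (𝓝 (C * (r - a))) := by
    have : Continuous fun s => C * (r - s) := by fun_prop
    exact (this.tendsto a).mono_left nhdsWithin_le_nhds
  exact le_of_tendsto_of_tendsto h2 h3
    (eventually_of_mem (Ioo_mem_nhdsGT hr.1) h1)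

section resets
variable {c : Params} {t₀ Tmin Tmax : ℝ} {t : ℕ → ℝ}

theorem resetTime_zero_sub_tau (c : Params) (t : ℕ → ℝ) :
    resetTime c t 0 - c.τ = t 0 / c.κ := by
  rw [resetTime, Params.τ, ← sub_div, add_sub_cancel_right]

/-- The absolute value makes the bound nonnegative by itself, so constants built from it can be
fixed before any transmission sequence is given. -/
theorem IsTransmission.resetTime_succ_sub_le (ht : IsTransmission t₀ Tmin Tmax t) (hκ : 0 < c.κ)
    (k : ℕ) : resetTime c t (k + 1) - resetTime c t k ≤ |Tmax| / c.κ := by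
  rw [resetTime, resetTime, ← sub_div]
  have := ht.upper k
  have := le_abs_self Tmax
  gcongr
  linarith

theorem IsTransmission.le_resetTime_succ_sub (ht : IsTransmission t₀ Tmin Tmax t) (hκ : 0 < c.κ)
    (k : ℕ) : Tmin / c.κ ≤ resetTime c t (k + 1) - resetTime c t k := by
  rw [resetTime, resetTime, ← sub_div]
  have := ht.lower k
  gcongr
  linarith

theorem IsTransmission.strictMono_resetTime (ht : IsTransmission t₀ Tmin Tmax t) (hκ : 0 < c.κ)
    (hT : 0 < Tmin) : StrictMono (resetTime c t) := by
  refine strictMono_nat_of_lt_succ fun k => ?_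
  have := ht.le_resetTime_succ_sub hκ k
  have := div_pos hT hκ
  linarith

theorem IsTransmission.resetTime_le (ht : IsTransmission t₀ Tmin Tmax t) (hκ : 0 < c.κ)
    (k : ℕ) : resetTime c t k ≤ resetTime c t 0 + k * (|Tmax| / c.κ) := by
  induction k with
  | zero => simp
  | succ k ih =>
    have := ht.resetTime_succ_sub_le hκ k
    push_cast
    linarith

theorem IsTransmission.tendsto_resetTime (ht : IsTransmission t₀ Tmin Tmax t) (hκ : 0 < c.κ)
    (hT : 0 < Tmin) : Tendsto (resetTime c t) atTop atTop := by
  have h1 : ∀ k : ℕ, resetTime c t 0 + k * (Tmin / c.κ) ≤ resetTime c t k := by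
    intro k
    induction k with
    | zero => simp
    | succ k ih =>
      have := ht.le_resetTime_succ_sub hκ k
      push_cast
      linarith
  exact tendsto_atTop_mono h1 (tendsto_atTop_add_const_left _ _
    (tendsto_natCast_atTop_atTop.atTop_mul_const (div_pos hT hκ)))

theorem IsTransmission.finite_resetTime (ht : IsTransmission t₀ Tmin Tmax t) (hκ : 0 < c.κ)
    (hT : 0 < Tmin) (a b : ℝ) : (Set.range (resetTime c t) ∩ Set.Ioo a b).Finite := by
  obtain ⟨N, hN⟩ := ((ht.tendsto_resetTime hκ hT).eventually_ge_atTop b).exists_forall_of_atTop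
  refine ((Set.finite_Iio N).image (resetTime c t)).subset ?_
  rintro _ ⟨⟨k, rfl⟩, hk⟩
  refine ⟨k, ?_, rfl⟩
  rw [Set.mem_Iio]
  by_contra! h
  exact absurd (hN k h) (not_le.2 hk.2)

theorem IsTransmission.exists_mem_Ioc (ht : IsTransmission t₀ Tmin Tmax t) (hκ : 0 < c.κ)
    (hT : 0 < Tmin) {r : ℝ} (hr : resetTime c t 0 < r) :
    ∃ k, r ∈ Set.Ioc (resetTime c t k) (resetTime c t (k + 1)) := by
  have hex := ((ht.tendsto_resetTime hκ hT).eventually_ge_atTop r).exists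
  classical
  have h1 := Nat.find_spec hex
  rcases hk : Nat.find hex with _ | k
  · rw [hk] at h1
    exact absurd h1 (not_le.2 hr)
  · rw [hk] at h1
    exact ⟨k, not_le.1 (Nat.find_min hex (by omega)), h1⟩

theorem IsTransmission.ne_resetTime (ht : IsTransmission t₀ Tmin Tmax t) (hκ : 0 < c.κ)
    (hT : 0 < Tmin) {r : ℝ} {k : ℕ}
    (hr : r ∈ Set.Ioo (resetTime c t k) (resetTime c t (k + 1))) (l : ℕ) :
    r ≠ resetTime c t l := by
  have hmono := ht.strictMono_resetTime hκ hT
  rintro rfl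
  have h1 := hmono.lt_iff_lt.1 hr.1
  have h2 := hmono.lt_iff_lt.1 hr.2
  omega

end resets

/-! ### Edge lengths and enclosure of the decoder error -/

theorem sum_Ioi_eq_sum_Ici {m i : Fin n} (hmi : (m : ℕ) + 1 = i) (f : Fin n → ℝ) :
    ∑ k ∈ Finset.Ioi m, f k = ∑ k : Set.Ici i, f k :=
  Finset.sum_subtype _ (fun k => by
    rw [Finset.mem_Ioi, Set.mem_Ici, Fin.lt_def, Fin.le_def]
    omega) f

theorem sum_eq_add_sum_Ici {m i : Fin n} (hmi : (m : ℕ) + 1 = i) (f : Fin n → ℝ)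
    (hf : ∀ k, k < m → f k = 0) : ∑ k, f k = f m + ∑ k : Set.Ici i, f k := by
  rw [← sum_Ioi_eq_sum_Ici hmi, ← Finset.sum_insert (by simp : m ∉ Finset.Ioi m)]
  symm
  refine Finset.sum_subset (Finset.subset_univ _) fun k _ hk => hf k ?_
  simp only [Finset.mem_insert, Finset.mem_Ioi, not_or, not_lt] at hk
  exact lt_of_le_of_ne hk.2 hk.1

theorem lt_iff_le_of_succ {m i : Fin n} (hmi : (m : ℕ) + 1 = i) {k : Fin n} : m < k ↔ i ≤ k := by
  rw [Fin.lt_def, Fin.le_def]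
  omega

theorem abs_le_norm_tailFrom {i k : Fin n} (hk : i ≤ k) (x : Fin n → ℝ) :
    |x k| ≤ ‖tailFrom i x‖ := by
  have := PiLp.norm_apply_le (tailFrom i x) ⟨k, hk⟩
  simpa [tailFrom] using this

/-- The edge lengths are constant between the resets. -/
theorem IsTrajectory.p_eq {c : Params} {σ : ℝ → ℝ}
    {h : (j : Fin n) → EuclideanSpace ℝ (Set.Ioi j) → ℝ} {ℓ : Fin n → ℝ} {t : ℕ → ℝ}
    {Λ : Matrix (Fin n) (Fin n) ℝ} {z e p : ℝ → Fin n → ℝ}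
    (htr : IsTrajectory c σ h ℓ t Λ z e p) {t₀ Tmin Tmax : ℝ}
    (ht : IsTransmission t₀ Tmin Tmax t) (hκ : 0 < c.κ) (hT : 0 < Tmin) {k : ℕ} {r : ℝ}
    (hr : r ∈ Set.Ioc (resetTime c t k) (resetTime c t (k + 1))) :
    p r = Λ.mulVec (p (resetTime c t k)) := by
  have hmono := (ht.strictMono_resetTime hκ hT).monotone
  funext j
  have h1 := abs_sub_le_of_tendsto_right (g := fun s => p s j) (C := 0)
    (tendsto_pi_nhds.1 (htr.p_reset k) j)
    ((continuousWithinAt_pi.1 (htr.p_left (k + 1)) j).mono fun x hx =>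
      ⟨(hmono (Nat.zero_le k)).trans hx.1.le, hx.2⟩)
    (fun x hx => ⟨0, by simp, htr.p_deriv x ((hmono (Nat.zero_le k)).trans_lt hx.1)
      (ht.ne_resetTime hκ hT hx) j⟩) hr
  rw [zero_mul] at h1
  exact sub_eq_zero.1 (abs_nonpos_iff.1 h1)

/-- A first row of the update matrix can be chosen so that the quantization regions contain the
quantization error also in the component `m`, while the edge lengths at the resets form a fixed
sequence that tends to zero. -/
theorem exists_row_forall_abs_le (c : Params) (hL : 0 < c.L) (hM : 0 < c.M) (hκ : 0 < c.κ)
    (σ : ℝ → ℝ) {h : (j : Fin n) → EuclideanSpace ℝ (Set.Ioi j) → ℝ} (hh : IsFeedforward c.M h)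
    {m i : Fin n} (hmi : (m : ℕ) + 1 = i) (ℓ : Fin n → ℝ) (Tmax : ℝ)
    {Λi : Matrix (Set.Ici i) (Set.Ici i) ℝ} (hΛi : SchurStable Λi) (Zi : ℝ) :
    ∃ (row : Set.Ici i → ℝ) (a : ℕ → Fin n → ℝ),
      (∀ j, m ≤ j → Tendsto (fun k => a k j) atTop (𝓝 0)) ∧
      ∀ (t₀ Ri Tmin : ℝ) (t : ℕ → ℝ), 0 < Tmin → IsTransmission t₀ Tmin Tmax t →
      ∀ Λ : Matrix (Fin n) (Fin n) ℝ, HasBlockForm m i row Λi Λ →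
      ∀ z e p : ℝ → Fin n → ℝ, IsTrajectory c σ h ℓ t Λ z e p →
        InductiveHyp c t z e p i Zi Ri →
        (∀ k j, m ≤ j → p (resetTime c t k) j = a k j) ∧
        ∀ j, m ≤ j → ∀ r, resetTime c t 0 ≤ r → |e r j| ≤ p r j / 2 := by
  -- The edge lengths from `i` on at the resets; neither the trajectory nor the transmission times
  -- enter.
  let q : ℕ → Set.Ici i → ℝ := fun k => (Λi ^ k).mulVec fun j => 2 * (Phi n c).mulVec ℓ j
  have hq0 : Tendsto q atTop (𝓝 0) := hΛi.tendsto_pow_mulVec _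
  have hqs : ∀ k, q (k + 1) = Λi.mulVec (q k) := fun k => by
    simp only [q, pow_succ', Matrix.mulVec_mulVec]
  obtain ⟨B, hB⟩ : ∃ B, ∀ k j, |q k j| ≤ B := by
    obtain ⟨B, hB⟩ := hq0.norm.bddAbove_range
    exact ⟨B, fun k j => (norm_le_pi_norm (q k) j).trans (hB ⟨k, rfl⟩)⟩
  -- The later coordinates of e + z(· - τ) are at most B/2 + Zi.
  obtain ⟨K, hK0, hK⟩ := exists_lipschitz_phiField c hh m (B + Zi)
  let G := |Tmax| / c.κ * (K + 1)
  -- The column sums of `Λi` turn the contribution of the current edges into G times the sum of the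
  -- next edges, which bound the errors on the coming interval.
  let row : Set.Ici i → ℝ := fun k => G * ∑ j, Λi j k
  have hrow : ∀ k, ∑ j, row j * q k j = G * ∑ j, q (k + 1) j := fun k => by
    simp only [row, hqs, Matrix.mulVec, dotProduct, mul_assoc, Finset.sum_mul, ← Finset.mul_sum]
    rw [Finset.sum_comm]
  let a₀ : ℕ → ℝ := Nat.rec (2 * (Phi n c).mulVec ℓ m) fun k x => 1 / 2 * x + ∑ j, row j * q k j
  have ha₀ : Tendsto a₀ atTop (𝓝 0) := by
    refine tendsto_zero_of_half_add (b := fun k => ∑ j, row j * q k j) (fun k => rfl) ?_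
    have : Continuous fun x : Set.Ici i → ℝ => ∑ j, row j * x j := by fun_prop
    have h1 := (this.tendsto 0).comp hq0
    simpa [Function.comp_def] using h1
  -- Only the value at `m` of the second branch matters; the values before `m` are irrelevant.
  let a : ℕ → Fin n → ℝ := fun k j => if hj : i ≤ j then q k ⟨j, hj⟩ else a₀ k
  have ham : ∀ k, a k m = a₀ k := fun k => dif_neg (by rw [Fin.le_def]; omega)
  have haj : ∀ k (j : Set.Ici i), a k j = q k j := fun k j => dif_pos j.2
  have hcases : ∀ j, m ≤ j → j = m ∨ i ≤ j := fun j hj => by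
    rw [Fin.le_def] at hj ⊢
    rw [Fin.ext_iff]
    omega
  refine ⟨row, a, fun j hj => ?_, ?_⟩
  · rcases hcases j hj with rfl | hj
    · simpa only [ham] using ha₀
    · simp only [a, dif_pos hj]
      exact tendsto_pi_nhds.1 hq0 ⟨j, hj⟩
  intro t₀ Ri Tmin t hT ht Λ hΛ z e p htr hyp
  have hmono := (ht.strictMono_resetTime (c := c) hκ hT).monotone
  have hp : ∀ k j, m ≤ j → p (resetTime c t k) j = a k j := by
    intro k
    induction k with
    | zero =>
      intro j hj
      rw [htr.p_init]
      rcases hcases j hj with rfl | hj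
      · rw [ham]
        rfl
      · rw [haj 0 ⟨j, hj⟩]
        simp [q]
    | succ k ih =>
      intro j hj
      rw [htr.p_eq ht hκ hT (Set.right_mem_Ioc.2 (ht.strictMono_resetTime hκ hT k.lt_succ_self))]
      have hsum : Λ.mulVec (p (resetTime c t k)) j =
          Λ j m * a₀ k + ∑ l : Set.Ici i, Λ j l * q k l := by
        rw [← ham, ← ih m le_rfl]
        refine (sum_eq_add_sum_Ici hmi (fun l => Λ j l * p (resetTime c t k) l) fun l hl => ?_).trans
          ?_
        · rw [hΛ.left_zero j l hj hl, zero_mul]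
        · congr 1
          refine Finset.sum_congr rfl fun l _ => ?_
          rw [ih l ((lt_iff_le_of_succ hmi).2 l.2).le, haj]
      rw [hsum]
      rcases hcases j hj with rfl | hj
      · rw [ham, hΛ.corner]
        simp only [hΛ.first_row]
        rfl
      · rw [haj (k + 1) ⟨j, hj⟩, hΛ.col_zero ⟨j, hj⟩, zero_mul, zero_add, hqs]
        exact Finset.sum_congr rfl fun l _ => by rw [hΛ.block ⟨j, hj⟩ l]
  have hpr : ∀ k, ∀ r ∈ Set.Ioc (resetTime c t k) (resetTime c t (k + 1)),
      p r = p (resetTime c t (k + 1)) := fun k r hr => by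
    rw [htr.p_eq ht hκ hT hr,
      htr.p_eq ht hκ hT (Set.right_mem_Ioc.2 (ht.strictMono_resetTime hκ hT k.lt_succ_self))]
  have hstep : ∀ k, |e (resetTime c t k) m| ≤ a k m / 2 →
      ∀ r ∈ Set.Ioc (resetTime c t k) (resetTime c t (k + 1)), |e r m| ≤ a (k + 1) m / 2 := by
    intro k hk r hr
    -- `Λi` need not have nonnegative entries; the edges are nonnegative because they bound errors.
    have hq_nonneg : 0 ≤ ∑ j, q (k + 1) j := Finset.sum_nonneg fun j _ => by
      have := hyp.e_le j j.2 _ (hmono (Nat.zero_le (k + 1)))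
      rw [hp _ _ ((lt_iff_le_of_succ hmi).2 j.2).le, haj] at this
      linarith [abs_nonneg (e (resetTime c t (k + 1)) j)]
    have hderiv : ∀ x ∈ Set.Ioo (resetTime c t k) (resetTime c t (k + 1)),
        ∃ d, |d| ≤ (K + 1) / 2 * ∑ j, q (k + 1) j ∧ HasDerivAt (fun s => e s m) d x := by
      intro x hx
      have hx0 : resetTime c t 0 < x := (hmono (Nat.zero_le k)).trans_lt hx.1
      have he : ∀ l : Fin n, m < l → |e x l| ≤ a (k + 1) l / 2 := fun l hl => by
        rw [← hp _ _ hl.le, ← hpr k x ⟨hx.1, hx.2.le⟩]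
        exact hyp.e_le l ((lt_iff_le_of_succ hmi).1 hl) x hx0.le
      have hz : ∀ l : Fin n, m < l → |z (x - c.τ) l| ≤ Zi := fun l hl => by
        refine (abs_le_norm_tailFrom ((lt_iff_le_of_succ hmi).1 hl) _).trans
          (hyp.z_bounded _ ?_)
        rw [← resetTime_zero_sub_tau]
        linarith
      have haB : ∀ l : Fin n, m < l → a (k + 1) l ≤ B ∧ 0 ≤ B := fun l hl => by
        have := hB (k + 1) ⟨l, (lt_iff_le_of_succ hmi).1 hl⟩
        rw [← haj] at this
        exact ⟨(le_abs_self _).trans this, (abs_nonneg _).trans this⟩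
      refine ⟨_, ?_, htr.e_deriv x hx0 (ht.ne_resetTime hκ hT hx) m⟩
      have h1 := hK (e x + z (x - c.τ)) (z (x - c.τ))
        (fun l hl => by
          rw [Pi.add_apply]
          refine (abs_add_le _ _).trans ?_
          linarith [he l hl, hz l hl, haB l hl])
        (fun l hl => by linarith [hz l hl, haB l hl])
      simp only [Pi.add_apply, add_sub_cancel_right] at h1
      have h2 : ∑ l ∈ Finset.Ioi m, |e x l| ≤ (∑ j, q (k + 1) j) / 2 := by
        rw [sum_Ioi_eq_sum_Ici hmi fun l => |e x l|, Finset.sum_div]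
        refine Finset.sum_le_sum fun j _ => ?_
        rw [← haj]
        exact he j ((lt_iff_le_of_succ hmi).2 j.2)
      rw [add_sub_assoc]
      calc _ ≤ ∑ l ∈ Finset.Ioi m, |e x l| + K * ∑ l ∈ Finset.Ioi m, |e x l| :=
            (abs_add_le _ _).trans (add_le_add (Finset.abs_sum_le_sum_abs _ _) h1)
        _ = (K + 1) * ∑ l ∈ Finset.Ioi m, |e x l| := by ring
        _ ≤ (K + 1) * ((∑ j, q (k + 1) j) / 2) := by gcongr
        _ = _ := by ring
    have h1 := abs_sub_le_of_tendsto_right (g := fun s => e s m)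
      (tendsto_pi_nhds.1 (htr.e_reset k) m)
      ((continuousWithinAt_pi.1 (htr.e_left (k + 1)) m).mono fun x hx =>
        ⟨(hmono (Nat.zero_le k)).trans hx.1.le, hx.2⟩) hderiv hr
    -- A point of [-a/2, a/2] moved towards 0 by a/4 lands in [-a/4, a/4]. The point 0 does not
    -- move, as the sign of 0 is 0.
    have h2 : |e (resetTime c t k) m +
        1 / 4 * (Real.sign (-e (resetTime c t k) m) * p (resetTime c t k) m)| ≤ a k m / 4 := by
      rw [hp k m le_rfl]
      rcases lt_trichotomy (e (resetTime c t k) m) 0 with h0 | h0 | h0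
      · rw [Real.sign_of_pos (by linarith), abs_le]
        rw [abs_of_neg h0] at hk
        constructor <;> linarith
      · rw [h0, abs_zero] at hk
        rw [h0, neg_zero, Real.sign_zero, zero_mul, mul_zero, add_zero, abs_zero]
        linarith
      · rw [Real.sign_of_neg (by linarith), abs_le]
        rw [abs_of_pos h0] at hk
        constructor <;> linarith
    have h3 : r - resetTime c t k ≤ |Tmax| / c.κ :=
      (sub_le_sub_right hr.2 _).trans (ht.resetTime_succ_sub_le hκ k)
    have h4 : (K + 1) / 2 * (∑ j, q (k + 1) j) * (r - resetTime c t k) ≤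
        G * (∑ j, q (k + 1) j) / 2 := by
      calc _ ≤ (K + 1) / 2 * (∑ j, q (k + 1) j) * (|Tmax| / c.κ) := by gcongr
        _ = _ := by ring
    -- Half of this is a_k/4 after the reset plus the maximal drift.
    have h5 : a (k + 1) m = 1 / 2 * a k m + G * ∑ j, q (k + 1) j := by
      rw [ham, ham, ← hrow]
    have h6 := abs_sub_abs_le_abs_sub (e r m) (e (resetTime c t k) m +
        1 / 4 * (Real.sign (-e (resetTime c t k) m) * p (resetTime c t k) m))
    rw [h5]
    linarith
  have hreset : ∀ k, |e (resetTime c t k) m| ≤ a k m / 2 := by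
    intro k
    induction k with
    | zero =>
      have : a 0 m = 2 * (Phi n c).mulVec ℓ m := ham 0
      rw [htr.e_init, Pi.neg_apply, abs_neg, this, mul_div_cancel_left₀ _ two_ne_zero]
      exact abs_le_Phi_mulVec c hM hL hκ htr.z_init m
    | succ k ih =>
      exact hstep k ih _ (Set.right_mem_Ioc.2 (ht.strictMono_resetTime hκ hT k.lt_succ_self))
  refine ⟨hp, fun j hj r hr => ?_⟩
  rcases hcases j hj with rfl | hj
  · rcases hr.eq_or_lt with rfl | hr
    · rw [hp 0 _ hj]
      exact hreset 0
    · obtain ⟨k, hk⟩ := ht.exists_mem_Ioc hκ hT hr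
      rw [hpr k r hk, hp _ _ hj]
      exact hstep k (hreset k) r hk
  · exact hyp.e_le j hj r hr

/-! ### Estimates for the state component -/

theorem sum_abs_le_of_abs_le_level {k : Fin n} {x : Fin n → ℝ}
    (hx : ∀ l, k < l → |x l| ≤ 1 / 4 * level l) : ∑ l ∈ Finset.Ioi k, |x l| ≤ 1 / 116 := by
  calc ∑ l ∈ Finset.Ioi k, |x l| ≤ ∑ l ∈ Finset.Ioi k, 1 / 4 * level l :=
        Finset.sum_le_sum fun l hl => hx l (Finset.mem_Ioi.1 hl)
    _ ≤ ∑ l, 1 / 4 * level l := Finset.sum_le_sum_of_subset_of_nonneg (Finset.subset_univ _)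
        fun l _ _ => by linarith [level_pos l]
    _ ≤ 1 / 116 := by
        rw [← Finset.mul_sum]
        linarith [sum_level_le (n := n)]

/-- The quadratic bound on a vector of ℓ¹ size 1/116, with P at most 30^{-n}/20. The factor 30^{-n}
is the smallest level, so one bound serves all components. -/
theorem abs_phiField_le_of_abs_le_level (c : Params) (hL : 0 < c.L) (hLM : c.L ≤ c.M)
    (hκ : 1 ≤ c.κ) (hLκ : c.L ≤ c.M * c.κ / (Nat.factorial (n + 1) : ℝ))
    {h : (j : Fin n) → EuclideanSpace ℝ (Set.Ioi j) → ℝ} (hh : IsFeedforward c.M h)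
    (hP : growthConst n c ≤ (20 * 30 ^ n * (n : ℝ))⁻¹) {k : Fin n} {x : Fin n → ℝ}
    (hx : ∀ l, k < l → |x l| ≤ 1 / 4 * level l) :
    |phiField c h x k| ≤ 1 / 1000 * (1 / 30 ^ n) := by
  have hS := sum_abs_le_of_abs_le_level hx
  have hS0 : 0 ≤ ∑ l ∈ Finset.Ioi k, |x l| := Finset.sum_nonneg fun _ _ => abs_nonneg _
  refine (abs_phiField_le c hL hLM hκ hLκ hh k x (by linarith)).trans ?_
  have hn : (1 : ℝ) ≤ n := by
    have := k.isLt
    exact_mod_cast (show 1 ≤ n by omega)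
  have h1 : (20 * 30 ^ n * (n : ℝ))⁻¹ ≤ 1 / 20 * (1 / 30 ^ n) := by
    rw [← one_div, ← one_div_mul_one_div, ← one_div_mul_one_div]
    exact mul_le_of_le_one_right (by positivity) ((div_le_one (by linarith)).2 hn)
  calc growthConst n c * (∑ l ∈ Finset.Ioi k, |x l|) ^ 2
      ≤ 1 / 20 * (1 / 30 ^ n) * (1 / 116) ^ 2 := by
        gcongr
        exact hP.trans h1
    _ ≤ _ := by
        have : (0 : ℝ) < 1 / 30 ^ n := by positivity
        linarith

theorem abs_control_le (c : Params) {σ : ℝ → ℝ} (hσ : IsSaturation σ) (t : ℕ → ℝ)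
    (z e : ℝ → Fin n → ℝ) (r : ℝ) : |control c σ t z e r| ≤ 1 / 30 := by
  unfold control
  split_ifs
  · norm_num
  · rw [abs_neg]
    simpa using abs_nestedSat_le hσ (fun j => e r j + z (r - c.τ) j) le_rfl

theorem norm_tailFrom_le {m i : Fin n} (hmi : (m : ℕ) + 1 = i) (x : Fin n → ℝ) :
    ‖tailFrom m x‖ ≤ |x m| + ‖tailFrom i x‖ := by
  refine abs_le_of_sq_le_sq' ?_ (by positivity) |>.2
  have h1 : ∀ j : Fin n, ‖tailFrom j x‖ ^ 2 = ∑ k ∈ Finset.Ici j, x k ^ 2 := fun j => by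
    have h := Finset.sum_subtype (Finset.Ici j) (p := (· ∈ Set.Ici j))
      (F := inferInstanceAs (Fintype (Set.Ici j))) (by simp) fun k => x k ^ 2
    rw [EuclideanSpace.norm_sq_eq, h]
    exact Finset.sum_congr rfl fun k _ => by simp [tailFrom]
  have h2 : Finset.Ici m = insert m (Finset.Ici i) := by
    ext k
    simp only [Finset.mem_insert, Finset.mem_Ici, Fin.le_def, Fin.ext_iff]
    omega
  have h3 : m ∉ Finset.Ici i := by
    rw [Finset.mem_Ici, Fin.le_def]
    omega
  rw [h1, h2, Finset.sum_insert h3, ← h1, ← sq_abs (x m)]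
  nlinarith [mul_nonneg (abs_nonneg (x m)) (norm_nonneg (tailFrom i x))]

/-- The component `z m` grows at most linearly. -/
theorem exists_deriv_bound (c : Params) {σ : ℝ → ℝ} (hσ : IsSaturation σ)
    {h : (j : Fin n) → EuclideanSpace ℝ (Set.Ioi j) → ℝ} (hh : IsFeedforward c.M h)
    (m : Fin n) (B : ℝ) : ∃ C : ℝ, ∀ (t : ℕ → ℝ) (z e : ℝ → Fin n → ℝ) (r : ℝ),
      (∀ k, m < k → |z r k| ≤ B) →
      |(∑ k ∈ Finset.Ioi m, z r k) + control c σ t z e r + phiField c h (z r) m| ≤ C := by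
  obtain ⟨K, hK0, hK⟩ := exists_lipschitz_phiField c hh m |B|
  refine ⟨n * |B| + 1 / 30 + (|phiField c h 0 m| + K * (n * |B|)), fun t z e r hz => ?_⟩
  have h1 : ∑ k ∈ Finset.Ioi m, |z r k| ≤ n * |B| := by
    refine (Finset.sum_le_card_nsmul _ _ |B| fun k hk =>
      (hz k (Finset.mem_Ioi.1 hk)).trans (le_abs_self B)).trans ?_
    rw [nsmul_eq_mul]
    have := (Finset.Ioi m).card_le_univ
    rw [Fintype.card_fin] at this
    gcongr
  have h2 := hK (z r) 0 (fun k hk => (hz k hk).trans (le_abs_self B)) (by simp)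
  simp only [Pi.zero_apply, sub_zero] at h2
  have h3 := abs_sub_abs_le_abs_sub (phiField c h (z r) m) (phiField c h 0 m)
  have h4 := mul_le_mul_of_nonneg_left h1 hK0
  have h5 := (Finset.abs_sum_le_sum_abs (z r) (Finset.Ioi m)).trans h1
  have h6 := abs_control_le c hσ t z e r
  exact (abs_add_three _ _ _).trans (by linarith)

/-- Above the level `ε / 4` the saturated feedback is at least `ε / 6`. -/
theorem IsSaturation.le_mul {σ : ℝ → ℝ} (hσ : IsSaturation σ) {ε x b : ℝ} (hε : 0 < ε)
    (hx : 1 / 4 * ε < x) (hb : |b| ≤ 1 / 12 * ε) : 1 / 6 * ε ≤ ε * σ ((x + b) / ε) := by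
  have h1 : 1 / 6 ≤ (x + b) / ε := by
    rw [le_div_iff₀ hε]
    linarith [(abs_le.1 hb).1]
  have h2 := hσ.monotone h1
  rw [hσ.eq_self (1 / 6) (by norm_num) (by norm_num)] at h2
  rw [mul_comm]
  exact mul_le_mul_of_nonneg_left h2 hε.le

theorem IsSaturation.mul_le {σ : ℝ → ℝ} (hσ : IsSaturation σ) {ε x b : ℝ} (hε : 0 < ε)
    (hx : x < -(1 / 4 * ε)) (hb : |b| ≤ 1 / 12 * ε) : ε * σ ((x + b) / ε) ≤ -(1 / 6 * ε) := by
  have := hσ.le_mul hε (x := -x) (b := -b) (by linarith) (by rwa [abs_neg])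
  rw [← neg_add, neg_div, hσ.odd] at this
  linarith

/-- Once the components after `m` are small, the component `z m` obeys a scalar saturated feedback
up to small errors. -/
theorem exists_saturated_form (c : Params) {σ : ℝ → ℝ} (hσ : IsSaturation σ)
    {h : (j : Fin n) → EuclideanSpace ℝ (Set.Ioi j) → ℝ} {t : ℕ → ℝ} {z e : ℝ → Fin n → ℝ}
    {m : Fin n} {r η : ℝ} (hη : n * η ≤ 1 / 1000 * (1 / 30 ^ n)) (hr : resetTime c t 0 ≤ r)
    (hz : ∀ k, m < k → |z (r - c.τ) k| ≤ 1 / 4 * level k)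
    (hd : ∀ k, m ≤ k → |z r k - z (r - c.τ) k| ≤ η) (he : ∀ k, m ≤ k → |e r k| ≤ η)
    (hφ : |phiField c h (z r) m| ≤ 1 / 1000 * (1 / 30 ^ n)) :
    ∃ b d, |b| ≤ 1 / 12 * level m ∧ |d| ≤ 1 / 100 * level m ∧
      (∑ k ∈ Finset.Ioi m, z r k) + control c σ t z e r + phiField c h (z r) m =
        -(level m * σ ((z r m + b) / level m)) + d := by
  have hη0 : 0 ≤ η := (abs_nonneg _).trans (he m le_rfl)
  have hn : (1 : ℝ) ≤ n := by
    have := m.isLt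
    exact_mod_cast (show 1 ≤ n by omega)
  have hηn : η ≤ n * η := le_mul_of_one_le_left hη0 hn
  have hlm := le_level m
  have hlm0 := level_pos m
  set w : Fin n → ℝ := fun j => e r j + z (r - c.τ) j with hw
  have h1 : nestedSat σ w n = ∑ k ∈ Finset.Ioi m, w k + nestedSat σ w (m + 1) := by
    refine nestedSat_eq_sum_add hσ fun j hj => (abs_add_le _ _).trans ?_
    have := le_level j
    have := level_pos j
    linarith [he j hj.le, hz j hj]
  have h2 : |nestedSat σ w m| ≤ 1 / 30 * level m := by
    refine (abs_nestedSat_le hσ w m.isLt.le).trans_eq ?_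
    rw [level]
    ring
  have hsum : ∀ f : Fin n → ℝ, (∀ k, m < k → |f k| ≤ η) →
      |∑ k ∈ Finset.Ioi m, f k| ≤ n * η := fun f hf => by
    refine (Finset.abs_sum_le_sum_abs _ _).trans ((Finset.sum_le_card_nsmul _ _ η fun k hk =>
      hf k (Finset.mem_Ioi.1 hk)).trans ?_)
    rw [nsmul_eq_mul]
    have := (Finset.Ioi m).card_le_univ
    rw [Fintype.card_fin] at this
    gcongr
  have h3 := hsum (fun k => z r k - z (r - c.τ) k) fun k hk => hd k hk.le
  have h4 := hsum (e r) fun k hk => he k hk.le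
  have h5 := hd m le_rfl
  have h6 := he m le_rfl
  -- b collects the error, the delay and the inner saturation: 2/1000 + 1/30 ≤ 1/12. In d, the
  -- linear terms of the feedback cancel those of the drift up to delays and errors; with the
  -- nonlinearity this leaves 3/1000 ≤ 1/100.
  refine ⟨e r m - (z r m - z (r - c.τ) m) + nestedSat σ w m,
    ∑ k ∈ Finset.Ioi m, (z r k - z (r - c.τ) k) - ∑ k ∈ Finset.Ioi m, e r k +
      phiField c h (z r) m, ?_, ?_, ?_⟩
  · rw [abs_le] at *
    constructor <;> linarith
  · rw [abs_le] at *
    constructor <;> linarith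
  · have h7 : z r m + (e r m - (z r m - z (r - c.τ) m) + nestedSat σ w m) =
        w m + nestedSat σ w m := by
      simp only [hw]
      ring
    rw [control, if_neg (not_lt.2 hr), h1, nestedSat_succ, h7, Finset.sum_sub_distrib]
    simp only [hw, Finset.sum_add_distrib]
    ring

end Feedforward

/-! ### The induction step -/

theorem lemma5 {n : ℕ} (c : Feedforward.Params)
    (hL : 0 < c.L) (hLM : c.L ≤ c.M) (hκ : 1 ≤ c.κ) (hθ : 0 ≤ c.θ)
    (hLκ : c.L ≤ c.M * c.κ / (Nat.factorial (n + 1) : ℝ))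
    (σ : ℝ → ℝ) (hσ : Feedforward.IsSaturation σ)
    (h : (j : Fin n) → EuclideanSpace ℝ (Set.Ioi j) → ℝ)
    (hh : Feedforward.IsFeedforward c.M h)
    (Pm τm : ℝ)
    (hP : Feedforward.growthConst n c ≤ Pm) (hPm : Pm ≤ (20 * 30 ^ n * (n : ℝ))⁻¹)
    (hτ : c.τ ≤ τm) (hτm : τm ≤ (6 * 30 ^ (n + 1) * (n : ℝ) * ((n : ℝ) + 1))⁻¹)
    (m i : Fin n) (hmi : (m : ℕ) + 1 = (i : ℕ))
    (ℓ : Fin n → ℝ) (Tmax : ℝ)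
    (Λi : Matrix (Set.Ici i) (Set.Ici i) ℝ) (hΛi : Feedforward.SchurStable Λi) (Zi : ℝ) :
    ∃ row : Set.Ici i → ℝ, ∀ t₀ Ri : ℝ, ∃ Zm Rm : ℝ,
      ∀ (Tmin : ℝ) (t : ℕ → ℝ), 0 < Tmin → Feedforward.IsTransmission t₀ Tmin Tmax t →
      ∀ Λ : Matrix (Fin n) (Fin n) ℝ, Feedforward.HasBlockForm m i row Λi Λ →
      ∀ z e p : ℝ → Fin n → ℝ, Feedforward.IsTrajectory c σ h ℓ t Λ z e p →
        Feedforward.InductiveHyp c t z e p i Zi Ri →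
        Feedforward.InductiveHyp c t z e p m Zm Rm := by
  open Feedforward in
  have hM : 0 < c.M := hL.trans_le hLM
  have hκ0 : 0 < c.κ := by linarith
  have hn : (1 : ℝ) ≤ n := by
    have := m.isLt
    exact_mod_cast (show 1 ≤ n by omega)
  have hτ0 : 0 ≤ c.τ := div_nonneg hθ hκ0.le
  obtain ⟨row, a, ha, henc⟩ :=
    exists_row_forall_abs_le c hL hM hκ0 σ hh hmi ℓ Tmax hΛi Zi
  obtain ⟨C, hC⟩ := exists_deriv_bound c hσ hh m Zi
  -- Below all the required error bounds at once, since j - m ≤ n and 30^{-n} ≤ ε_j.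
  set δ : ℝ := 1 / (2 * (n : ℝ)) * (1 / 80 ^ (n + 2)) * (1 / 30 ^ n) with hδ
  have hδ0 : 0 < δ := by positivity
  have hu : (0 : ℝ) < 1 / 30 ^ n := by positivity
  have hnδ : n * δ ≤ 1 / 1000 * (1 / 30 ^ n) := by
    have h1 : (80 : ℝ) ^ 2 ≤ 80 ^ (n + 2) := pow_le_pow_right₀ (by norm_num) (by omega)
    have h2 : n * δ = 1 / 2 * (1 / 80 ^ (n + 2)) * (1 / 30 ^ n) := by
      rw [hδ]
      field_simp
    rw [h2]
    refine mul_le_mul_of_nonneg_right ?_ hu.le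
    have h3 : (1 : ℝ) / 80 ^ (n + 2) ≤ 1 / 80 ^ 2 := one_div_le_one_div_of_le (by norm_num) h1
    linarith
  have hnτ : n * (1 / 15 * c.τ) ≤ 1 / 1000 * (1 / 30 ^ n) := by
    have h1 : c.τ ≤ 1 / 6 * (1 / 30 * (1 / 30 ^ n)) * (1 / n) := by
      refine (hτ.trans hτm).trans ?_
      calc (6 * 30 ^ (n + 1) * (n : ℝ) * ((n : ℝ) + 1))⁻¹
          ≤ (6 * 30 ^ (n + 1) * (n : ℝ) * 1)⁻¹ := by
            gcongr
            linarith
        _ = _ := by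
            rw [pow_succ]
            field_simp
    have h2 : n * c.τ ≤ 1 / 180 * (1 / 30 ^ n) := by
      calc n * c.τ ≤ n * (1 / 6 * (1 / 30 * (1 / 30 ^ n)) * (1 / n)) := by gcongr
        _ = _ := by
            field_simp
            norm_num
    linarith
  obtain ⟨N, hN⟩ : ∃ N, ∀ k ≥ N, ∀ j, m ≤ j → a k j ≤ δ := by
    have : ∀ᶠ k in atTop, ∀ j, m ≤ j → a k j ≤ δ := by
      rw [eventually_all]
      intro j
      by_cases hj : m ≤ j
      · filter_upwards [(ha j hj).eventually (gt_mem_nhds hδ0)] with k hk _ using hk.le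
      · exact Eventually.of_forall fun k hk => absurd hk hj
    exact this.exists_forall_of_atTop
  refine ⟨row, fun t₀ Ri => ?_⟩
  have hlm0 := level_pos m
  -- From here on the delayed arguments also lie past `Ri`, and the reset that closes the current
  -- interval has index at least `N`.
  set R₁ := max (Ri + c.τ) ((t₀ + c.θ) / c.κ + N * (|Tmax| / c.κ) + 1) with hR₁
  set A := |(Phi n c).mulVec ℓ m| + |C| * |R₁ - t₀ / c.κ| with hA
  have hA0 : 0 ≤ A := by positivity
  -- `A` bounds |z_m| up to `R₁`; the waiting time is that of a descent from `A` at rate ε_m/10.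
  -- `Zi` is not yet known to be positive here, hence its absolute value.
  refine ⟨A + 1 + |Zi|, R₁ + A / (1 / 10 * level m), ?_⟩
  intro Tmin t hT ht Λ hΛ z e p htr hyp
  obtain ⟨hp, hep⟩ := henc t₀ Ri Tmin t hT ht Λ hΛ z e p htr hyp
  have ht0 : t 0 = t₀ := ht.start
  have hRi : Ri + c.τ ≤ R₁ := le_max_left _ _
  have hstart : t 0 / c.κ ≤ resetTime c t 0 := by
    rw [← resetTime_zero_sub_tau]
    linarith
  have hRi0 := hyp.start_lt
  have hfin := ht.finite_resetTime (c := c) hκ0 hT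
  have hlt : ∀ k, m < k ↔ i ≤ k := fun k => lt_iff_le_of_succ hmi
  have hzcont : ∀ (k : Fin n) (x y : ℝ), t 0 / c.κ ≤ x →
      ContinuousOn (fun s => z s k) (Set.Icc x y) := fun k x y hx =>
    ((continuousOn_pi.1 htr.z_cont k).mono fun s hs => hx.trans hs.1)
  have hnot : ∀ x : ℝ, x ∉ Set.range (resetTime c t) → ∀ k, x ≠ resetTime c t k :=
    fun x hx k hk => hx ⟨k, hk.symm⟩
  have hesmall : ∀ j, m ≤ j → ∀ r, R₁ ≤ r → |e r j| ≤ δ := by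
    intro j hj r hr
    have h1 : (t₀ + c.θ) / c.κ + N * (|Tmax| / c.κ) + 1 ≤ r := (le_max_right _ _).trans hr
    have h2 : resetTime c t 0 = (t₀ + c.θ) / c.κ := by rw [resetTime, ht0]
    have h3 : resetTime c t 0 < r := by linarith
    obtain ⟨k, hk⟩ := ht.exists_mem_Ioc hκ0 hT h3
    have h4 : N ≤ k + 1 := by
      by_contra! hlt
      have h5 := ht.resetTime_le hκ0 (k + 1)
      have h6 : ((k + 1 : ℕ) : ℝ) * (|Tmax| / c.κ) ≤ N * (|Tmax| / c.κ) := by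
        gcongr
      linarith [hk.2]
    have h5 := hep j hj r h3.le
    have h6 : p r = p (resetTime c t (k + 1)) := by
      rw [htr.p_eq ht hκ0 hT hk, htr.p_eq ht hκ0 hT
        (Set.right_mem_Ioc.2 (ht.strictMono_resetTime hκ0 hT k.lt_succ_self))]
    rw [h6, hp _ _ hj] at h5
    linarith [hN _ h4 j hj]
  have hzi : ∀ k, m < k → ∀ r, Ri ≤ r → |z r k| ≤ 1 / 4 * level k := fun k hk r hr =>
    hyp.z_small k ((hlt k).1 hk) r hr
  have hφ : ∀ k, m ≤ k → ∀ r, Ri ≤ r → |phiField c h (z r) k| ≤ 1 / 1000 * (1 / 30 ^ n) :=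
    fun k hk r hr => abs_phiField_le_of_abs_le_level c hL hLM hκ hLκ hh (hP.trans hPm)
      fun l hl => hzi l (hk.trans_lt hl) r hr
  -- The speed is at most 1/116 (later components) + 1/30 (control) + 1/1000 (nonlinearity) ≤ 1/15.
  have hdelay : ∀ k, m ≤ k → ∀ r, R₁ ≤ r → |z r k - z (r - c.τ) k| ≤ 1 / 15 * c.τ := by
    intro k hk r hr
    have h1 := abs_sub_le_mul_of_abs_deriv_le_off_finite (f := fun s => z s k) (C := 1 / 15)
      (a := r - c.τ) (b := r) (by linarith) (hfin _ _) (hzcont k _ _ (by linarith))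
      fun x hx hxS => by
        have hx' : Ri ≤ x := by linarith [hx.1]
        refine ⟨_, ?_, htr.z_deriv x (by linarith) (hnot x hxS) k⟩
        have h2 := (Finset.abs_sum_le_sum_abs (z x) (Finset.Ioi k)).trans
          (sum_abs_le_of_abs_le_level fun l hl => hzi l (hk.trans_lt hl) x hx')
        have h3 := abs_control_le c hσ t z e x
        have h4 := hφ k hk x hx'
        have h5 : (1 : ℝ) / 30 ^ n ≤ 1 :=
          (div_le_one (by positivity)).2 (one_le_pow₀ (by norm_num))
        exact (abs_add_three _ _ _).trans (by linarith)
    rwa [sub_sub_cancel] at h1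
  have hz0 : ∀ r, t 0 / c.κ ≤ r → r ≤ R₁ → |z r m| ≤ A := by
    intro r hr hr1
    have h1 := abs_sub_le_mul_of_abs_deriv_le_off_finite (f := fun s => z s m) (C := C) hr
      (hfin _ _) (hzcont m _ _ le_rfl) fun x hx hxS =>
        ⟨_, hC t z e x fun k hk => (abs_le_norm_tailFrom ((hlt k).1 hk) _).trans
          (hyp.z_bounded x hx.1.le), htr.z_deriv x hx.1 (hnot x hxS) m⟩
    have h2 := abs_le_Phi_mulVec c hM hL hκ0 htr.z_init m
    have h3 : C * (r - t 0 / c.κ) ≤ |C| * |R₁ - t₀ / c.κ| := by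
      rw [← ht0]
      refine mul_le_mul (le_abs_self C) ?_ (by linarith) (abs_nonneg C)
      exact le_trans (by linarith) (le_abs_self _)
    have h4 := abs_sub_abs_le_abs_sub (z r m) (z (t 0 / c.κ) m)
    linarith [le_abs_self ((Phi n c).mulVec ℓ m)]
  set η := max δ (1 / 15 * c.τ) with hη
  have hnη : n * η ≤ 1 / 1000 * (1 / 30 ^ n) := by
    rcases max_choice δ (1 / 15 * c.τ) with h | h
    · rwa [hη, h]
    · rwa [hη, h]
  have hform : ∀ x, R₁ ≤ x → ∃ b d, |b| ≤ 1 / 12 * level m ∧ |d| ≤ 1 / 100 * level m ∧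
      (∑ k ∈ Finset.Ioi m, z x k) + control c σ t z e x + phiField c h (z x) m =
        -(level m * σ ((z x m + b) / level m)) + d := fun x hx =>
    exists_saturated_form c hσ hnη (by linarith)
      (fun k hk => hzi k hk _ (by linarith))
      (fun k hk => (hdelay k hk x hx).trans (le_max_right _ _))
      (fun k hk => (hesmall k hk x hx).trans (le_max_left _ _))
      (hφ m le_rfl x (by linarith))
  have hR₁0 : t 0 / c.κ ≤ R₁ := by linarith
  -- Outside the band the feedback contributes at least ε_m/6 and the disturbance at most ε_m/100,
  -- leaving a rate of at least ε_m/10.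
  have hlater : ∀ r, R₁ ≤ r →
      |z r m| ≤ max (1 / 4 * level m) (A - 1 / 10 * level m * (r - R₁)) := by
    intro r hr
    obtain ⟨hz1, hz2⟩ := abs_le.1 (hz0 R₁ hR₁0 le_rfl)
    have hup := le_max_of_deriv_le_of_above (f := fun s => z s m) (c := 1 / 10 * level m)
      (α := 1 / 4 * level m) (by positivity) hr (hfin _ _) (hzcont m _ _ hR₁0)
      fun x hx hxS hlt => by
        refine ⟨_, ?_, htr.z_deriv x (hR₁0.trans_lt hx.1) (hnot x hxS) m⟩
        obtain ⟨b, d, hb, hd, heq⟩ := hform x hx.1.le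
        rw [heq]
        linarith [hσ.le_mul hlm0 hlt hb, (abs_le.1 hd).2]
    have hlow := le_max_of_deriv_le_of_above (f := fun s => -z s m) (c := 1 / 10 * level m)
      (α := 1 / 4 * level m) (by positivity) hr (hfin _ _) (hzcont m _ _ hR₁0).neg
      fun x hx hxS hlt => by
        refine ⟨_, ?_, (htr.z_deriv x (hR₁0.trans_lt hx.1) (hnot x hxS) m).neg⟩
        obtain ⟨b, d, hb, hd, heq⟩ := hform x hx.1.le
        rw [heq]
        linarith [hσ.mul_le hlm0 (x := z x m) (by linarith) hb, (abs_le.1 hd).1]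
    exact abs_le'.2 ⟨hup.trans (max_le_max le_rfl (by linarith)),
      hlow.trans (max_le_max le_rfl (by linarith))⟩
  have hwait : 0 ≤ A / (1 / 10 * level m) := by positivity
  refine ⟨by positivity, fun r hr => ?_, hep, ?_, ?_, fun j hj r hr => ?_, fun j hj r hr => ?_⟩
  · refine (norm_tailFrom_le hmi (z r)).trans ?_
    have h1 := hyp.z_bounded r hr
    have h2 : |z r m| ≤ A + 1 := by
      rcases le_total r R₁ with hr1 | hr1
      · linarith [hz0 r hr hr1]
      · refine (hlater r hr1).trans (max_le ?_ ?_)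
        · have h3 : level m ≤ 1 := by
            rw [level]
            exact (div_le_one (by positivity)).2 (one_le_pow₀ (by norm_num))
          linarith
        · have : 0 ≤ 1 / 10 * level m * (r - R₁) := mul_nonneg (by positivity) (by linarith)
          linarith
    linarith [le_abs_self Zi]
  · linarith [hyp.tau_lt]
  · linarith
  · rcases hj.eq_or_lt with rfl | hj
    · refine (hlater r (by linarith)).trans (max_le le_rfl ?_)
      have h1 : A ≤ 1 / 10 * level m * (r - R₁) := by
        rw [mul_comm, ← div_le_iff₀ (by positivity)]
        linarith
      linarith
    · exact hzi j hj r (by linarith)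
  · refine (hesmall j hj r (by linarith)).trans ?_
    have h1 : (80 : ℝ) ^ ((j : ℕ) - (m : ℕ) + 2) ≤ 80 ^ (n + 2) :=
      pow_le_pow_right₀ (by norm_num) (by omega)
    have h2 := le_level j
    rw [hδ]
    gcongr
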